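/- Let $\mathbb N=\{1,2,3,\dots\}$. For finite sets $E,F\subset\mathbb N$ write $E<F$ if every element of $E$ is smaller than every element of $F$. For every countable limit ordinal $\lambda$ fix a strictly increasing sequence of ordinals $(\lambda_n)_{n\ge1}$ with supremum $\lambda$. Define the Schreier families $\mathcal S_\alpha$, $\alpha<\omega_1$, by $\mathcal S_0=\{\varnothing\}\cup\{\{n\}:n\in\mathbb N\}$, $$\mathcal S_{\alpha+1}=\Bigl\{\bigcup_{k=1}^nE_k:\ E_k\in\mathcal S_\alpha,\ E_1<\dots<E_n,\ n\le\min\bigcup_{k=1}^n E_k\Bigr\},$$ $$\mathcal S_\lambda=\{E:\ \exists\, n\le\min E,\ E\in\mathcal S_{\lambda_n+1}\}\quad(\lambda\text{ a limit ordinal}),$$ with $\min\varnothing=\infty$. For a finitely supported real sequence $x\in c_{00}$ put $\|x\|_\alpha=\sup_{E\in\mathcal S_\alpha}\sum_{i\in E}|x_i|$, and for $1<p<\infty$ let $X^p_\alpha$ be the completion of $c_{00}$ under the norm $$\|x\|_{X^p_\alpha}=\sup\Bigl\{\Bigl(\sum_{n=1}^\infty\bigl\|P_{[k_{n-1},k_n)}x\bigr\|_\alpha^p\Bigr)^{1/p}:\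 1\le k_0<k_1<\cdots\Bigr\},$$ where $P_{[k,l)}x$ is the restriction of $x$ to $\{k,\dots,l-1\}$. **Lemma.** Let $\alpha<\omega_1$ and $1<p<\infty$. The unit vectors $(e_n)$ form a normalized, $1$-unconditional Schauder basis of $X^p_\alpha$, and this basis is: 1. shrinking: the closed linear span of the coordinate functionals $(e_n^*)$ is the whole dual $(X^p_\alpha)^*$; 2. boundedly complete: if $\sup_N\bigl\|\sum_{n=1}^Nc_ne_n\bigr\|<\infty$ for scalars $(c_n)$, then $\sum_{n=1}^\infty c_ne_n$ converges in $X^p_\alpha$; 3. $1$-right dominant: if $m_1<m_2<\cdots$ and $k_1<k_2<\cdots$ are natural numbers with $m_n\le k_n$ for all $n$, then $\bigl\|\sum_n a_ne_{m_n}\bigr\|\le\bigl\|\sum_n a_ne_{k_n}\bigr\|$ for all finitely supported real sequences $(a_n)$; 4. and it satisfies subsequential $4$-$X^p_\alpha$-upper block estimates in $X^p_\alpha$: if $(z_n)$ is a normalized block sequence of $(e_n)$ (norm-one vectors with finite supports, $\max\operatorname{supp}z_n<\min\operatorname{supp}z_{n+1}$) and $m_n=\min\operatorname{supp}z_n$,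 then $\bigl\|\sum_n a_nz_n\bigr\|\le4\bigl\|\sum_n a_ne_{m_n}\bigr\|$ for all finitely supported real sequences $(a_n)$. -/

import Mathlib

/-! Throughout, `ℕ+ = {1, 2, 3, …}` plays the role of the index set `ℕ` of a basis. -/

noncomputable section

namespace Baernstein

open Filter Topology

/-! ### Schreier families -/

/-- A choice, for every countable limit ordinal `l`, of a sequence `a l 1 < a l 2 < …` of
ordinals increasing strictly to `l`. -/
def IsLimitSystem (a : Ordinal.{0} → ℕ+ → Ordinal.{0}) : Prop :=
  ∀ l : Ordinal.{0}, l < Ordinal.omega 1 → Order.IsSuccLimit l →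
    StrictMono (a l) ∧ IsLUB (Set.range (a l)) l

/-- `E < F` for finite sets: every element of `E` is smaller than every element of `F`
(no condition if one of them is empty). -/
def SetLT (E F : Finset ℕ+) : Prop := ∀ i ∈ E, ∀ j ∈ F, i < j

/-- The successor step: all unions `E₁ ∪ ⋯ ∪ Eₙ` with `E₁ < ⋯ < Eₙ` in the family `S` and
`n` at most the minimum of the union. (Some of the `Eₖ` may be empty; dropping these only
decreases `n`.) -/
def schreierSucc (S : Set (Finset ℕ+)) : Set (Finset ℕ+) :=
  {E | ∃ (n : ℕ) (D : Fin n → Finset ℕ+), (∀ k, D k ∈ S) ∧ (∀ k l, k < l → SetLT (D k) (D l)) ∧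
    (∀ i ∈ E, n ≤ (i : ℕ)) ∧ E = Finset.univ.biUnion D}

/-- The Schreier family `S_α`, by transfinite recursion: `S_0` consists of the sets with at most
one element, `S_{α+1}` is given by `schreierSucc`, and for a limit ordinal `l`,
`S_l = {E : ∃ n ≤ min E, E ∈ S_{a l n + 1}}`. (The condition `a l n + 1 < l` is automatic
for an `IsLimitSystem`.) -/
def schreierFamily (a : Ordinal.{0} → ℕ+ → Ordinal.{0}) (α : Ordinal.{0}) : Set (Finset ℕ+) :=
  Ordinal.limitRecOn (motive := fun _ => Set (Finset ℕ+)) α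
    {E | E.card ≤ 1}
    (fun _ S => schreierSucc S)
    (fun l _ S => {E | ∃ (n : ℕ+) (h : a l n + 1 < l), (∀ i ∈ E, n ≤ i) ∧ E ∈ S (a l n + 1) h})

theorem schreierFamily_zero (a : Ordinal.{0} → ℕ+ → Ordinal.{0}) :
    schreierFamily a 0 = {E | E.card ≤ 1} := by
  simp [schreierFamily]

theorem schreierFamily_add_one (a : Ordinal.{0} → ℕ+ → Ordinal.{0}) (α : Ordinal.{0}) :
    schreierFamily a (α + 1) = schreierSucc (schreierFamily a α) := by
  simp [schreierFamily]

theorem schreierFamily_limit (a : Ordinal.{0} → ℕ+ → Ordinal.{0}) (ha : IsLimitSystem a)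
    (l : Ordinal.{0}) (hl : Order.IsSuccLimit l) (hl1 : l < Ordinal.omega 1) :
    schreierFamily a l =
      {E | ∃ n : ℕ+, (∀ i ∈ E, n ≤ i) ∧ E ∈ schreierFamily a (a l n + 1)} := by
  have key : ∀ n, a l n + 1 < l := fun n => by
    obtain ⟨h1, h2⟩ := ha l hl1 hl
    exact hl.add_one_lt ((h1 (PNat.lt_add_right n 1)).trans_le (h2.1 ⟨n + 1, rfl⟩))
  ext E
  rw [schreierFamily, Ordinal.limitRecOn_limit _ _ _ _ hl]
  simp only [Set.mem_ofPred_eq]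
  exact ⟨fun ⟨n, _, h⟩ => ⟨n, h⟩, fun ⟨n, h⟩ => ⟨n, key n, h⟩⟩

/-! ### The Schreier norm and the Baernstein norm on `c₀₀` -/

/-- `‖x‖_F = sup_{E ∈ F} ‖E x‖₁` for `x ∈ c₀₀`. -/
def schreierNorm (F : Set (Finset ℕ+)) (x : ℕ+ →₀ ℝ) : ℝ :=
  ⨆ E : F, ∑ i ∈ E.1, |x i|

/-- The restriction `P_{[m, n)} x` of `x ∈ c₀₀` to the interval `[m, n)`. -/
def intervalProj (m n : ℕ+) (x : ℕ+ →₀ ℝ) : ℕ+ →₀ ℝ :=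
  x.filter (fun i => m ≤ i ∧ i < n)

/-- The norm of `(X_F)^{ℓ_p}` on `c₀₀`:
`sup { (∑ₙ ‖P_{[kₙ, kₙ₊₁)} x‖_F ^ p) ^ (1/p) : 1 ≤ k₀ < k₁ < ⋯ }`. -/
def baernsteinNorm (F : Set (Finset ℕ+)) (p : ℝ) (x : ℕ+ →₀ ℝ) : ℝ :=
  ⨆ k : {k : ℕ → ℕ+ // StrictMono k},
    (∑' n : ℕ, schreierNorm F (intervalProj (k.1 n) (k.1 (n + 1)) x) ^ p) ^ (1 / p)

/-! ### Facts needed for the norm axioms -/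

theorem sum_abs_le (E : Finset ℕ+) (x : ℕ+ →₀ ℝ) :
    ∑ i ∈ E, |x i| ≤ ∑ i ∈ x.support, |x i| := by
  classical
  rw [← Finset.sum_filter_of_ne (s := E) (p := fun i => i ∈ x.support)]
  · exact Finset.sum_le_sum_of_subset_of_nonneg (fun i hi => (Finset.mem_filter.1 hi).2)
      fun _ _ _ => abs_nonneg _
  · intro i _ h
    simpa using h

theorem schreier_bddAbove (F : Set (Finset ℕ+)) (x : ℕ+ →₀ ℝ) :
    BddAbove (Set.range fun E : F => ∑ i ∈ E.1, |x i|) :=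
  ⟨∑ i ∈ x.support, |x i|, by rintro _ ⟨E, rfl⟩; exact sum_abs_le E.1 x⟩

theorem schreierNorm_nonneg (F : Set (Finset ℕ+)) (x : ℕ+ →₀ ℝ) : 0 ≤ schreierNorm F x :=
  Real.iSup_nonneg fun _ => Finset.sum_nonneg fun _ _ => abs_nonneg _

theorem schreierNorm_le (F : Set (Finset ℕ+)) (x : ℕ+ →₀ ℝ) :
    schreierNorm F x ≤ ∑ i ∈ x.support, |x i| :=
  Real.iSup_le (fun E => sum_abs_le E.1 x) (Finset.sum_nonneg fun _ _ => abs_nonneg _)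

theorem schreierNorm_zero (F : Set (Finset ℕ+)) : schreierNorm F 0 = 0 := by
  simp [schreierNorm]

theorem schreierNorm_add_le (F : Set (Finset ℕ+)) (x y : ℕ+ →₀ ℝ) :
    schreierNorm F (x + y) ≤ schreierNorm F x + schreierNorm F y := by
  refine Real.iSup_le (fun E => ?_)
    (add_nonneg (schreierNorm_nonneg F x) (schreierNorm_nonneg F y))
  calc ∑ i ∈ E.1, |(x + y) i| ≤ ∑ i ∈ E.1, (|x i| + |y i|) :=
        Finset.sum_le_sum fun i _ => abs_add_le _ _
    _ = ∑ i ∈ E.1, |x i| + ∑ i ∈ E.1, |y i| := Finset.sum_add_distrib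
    _ ≤ _ := add_le_add (le_ciSup (schreier_bddAbove F x) E) (le_ciSup (schreier_bddAbove F y) E)

theorem schreierNorm_smul (F : Set (Finset ℕ+)) (c : ℝ) (x : ℕ+ →₀ ℝ) :
    schreierNorm F (c • x) = |c| * schreierNorm F x := by
  simp only [schreierNorm, Finsupp.smul_apply, smul_eq_mul, abs_mul, ← Finset.mul_sum]
  exact (Real.mul_iSup_of_nonneg (abs_nonneg c) _).symm

theorem intervalProj_add (m n : ℕ+) (x y : ℕ+ →₀ ℝ) :
    intervalProj m n (x + y) = intervalProj m n x + intervalProj m n y :=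
  Finsupp.filter_add

theorem intervalProj_smul (m n : ℕ+) (c : ℝ) (x : ℕ+ →₀ ℝ) :
    intervalProj m n (c • x) = c • intervalProj m n x :=
  Finsupp.filter_smul

/-- For strictly increasing `k`, only finitely many of the restrictions to `[kₙ, kₙ₊₁)` are
nonzero. -/
theorem exists_forall_intervalProj_eq_zero (x : ℕ+ →₀ ℝ) (k : ℕ → ℕ+) (hk : StrictMono k) :
    ∃ N : ℕ, ∀ n, N ≤ n → intervalProj (k n) (k (n + 1)) x = 0 := by
  refine ⟨x.support.sup (fun i => (i : ℕ)) + 1, fun n hn => ?_⟩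
  ext i
  rw [intervalProj, Finsupp.filter_apply]
  split_ifs with h
  · by_contra hi
    have h1 : (i : ℕ) ≤ x.support.sup (fun i => (i : ℕ)) :=
      Finset.le_sup (f := fun i : ℕ+ => (i : ℕ)) (Finsupp.mem_support_iff.2 hi)
    have h2 : n ≤ (k n : ℕ) := by
      have : StrictMono fun n => (k n : ℕ) := fun a b hab => hk hab
      exact this.id_le n
    have h3 : (k n : ℕ) ≤ i := h.1
    omega
  · rfl

theorem summable_blocks (F : Set (Finset ℕ+)) {p : ℝ} (hp : 1 ≤ p) (x : ℕ+ →₀ ℝ)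
    (k : ℕ → ℕ+) (hk : StrictMono k) :
    Summable fun n : ℕ => schreierNorm F (intervalProj (k n) (k (n + 1)) x) ^ p := by
  obtain ⟨N, hN⟩ := exists_forall_intervalProj_eq_zero x k hk
  refine summable_of_ne_finset_zero (s := Finset.range N) fun n hn => ?_
  rw [hN n (by simpa using hn), schreierNorm_zero, Real.zero_rpow (by linarith)]

theorem baernstein_bddAbove (F : Set (Finset ℕ+)) {p : ℝ} (hp : 1 ≤ p) (x : ℕ+ →₀ ℝ) :
    BddAbove (Set.range fun k : {k : ℕ → ℕ+ // StrictMono k} =>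
      (∑' n : ℕ, schreierNorm F (intervalProj (k.1 n) (k.1 (n + 1)) x) ^ p) ^ (1 / p)) := by
  classical
  set M := x.support.sup (fun i => (i : ℕ)) + 1 with hM
  refine ⟨((M : ℝ) * (∑ i ∈ x.support, |x i|) ^ p) ^ (1 / p), ?_⟩
  rintro _ ⟨⟨k, hk⟩, rfl⟩
  have hzero : ∀ n, n ∉ Finset.range M →
      schreierNorm F (intervalProj (k n) (k (n + 1)) x) ^ p = 0 := by
    intro n hn
    have hz : intervalProj (k n) (k (n + 1)) x = 0 := by
      ext i
      rw [intervalProj, Finsupp.filter_apply]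
      split_ifs with h
      · by_contra hi
        have h1 : (i : ℕ) ≤ x.support.sup (fun i => (i : ℕ)) :=
          Finset.le_sup (f := fun i : ℕ+ => (i : ℕ)) (Finsupp.mem_support_iff.2 hi)
        have h2 : n ≤ (k n : ℕ) := by
          have : StrictMono fun n => (k n : ℕ) := fun a b hab => hk hab
          exact this.id_le n
        have h3 : (k n : ℕ) ≤ i := h.1
        simp only [Finset.mem_range] at hn
        omega
      · rfl
    rw [hz, schreierNorm_zero, Real.zero_rpow (by linarith)]
  have hb : ∀ n, schreierNorm F (intervalProj (k n) (k (n + 1)) x) ≤ ∑ i ∈ x.support, |x i| := by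
    intro n
    refine (schreierNorm_le F _).trans ?_
    refine (Finset.sum_le_sum fun i _ => ?_).trans (sum_abs_le _ x)
    rw [intervalProj, Finsupp.filter_apply]
    split_ifs
    · exact le_rfl
    · simp
  refine Real.rpow_le_rpow (tsum_nonneg fun n => Real.rpow_nonneg (schreierNorm_nonneg F _) _) ?_
    (by positivity)
  simp only
  rw [tsum_eq_sum hzero]
  calc _ ≤ ∑ _n ∈ Finset.range M, (∑ i ∈ x.support, |x i|) ^ p :=
        Finset.sum_le_sum fun n _ =>
          Real.rpow_le_rpow (schreierNorm_nonneg F _) (hb n) (by linarith)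
    _ = _ := by simp

theorem baernsteinNorm_nonneg (F : Set (Finset ℕ+)) (p : ℝ) (x : ℕ+ →₀ ℝ) :
    0 ≤ baernsteinNorm F p x :=
  Real.iSup_nonneg fun _ => Real.rpow_nonneg
    (tsum_nonneg fun _ => Real.rpow_nonneg (schreierNorm_nonneg F _) _) _

theorem baernsteinNorm_add_le (F : Set (Finset ℕ+)) {p : ℝ} (hp : 1 ≤ p) (x y : ℕ+ →₀ ℝ) :
    baernsteinNorm F p (x + y) ≤ baernsteinNorm F p x + baernsteinNorm F p y := by
  refine Real.iSup_le (fun k => ?_)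
    (add_nonneg (baernsteinNorm_nonneg F p x) (baernsteinNorm_nonneg F p y))
  obtain ⟨h1, h2⟩ := Real.Lp_add_le_tsum_of_nonneg hp
    (fun n => schreierNorm_nonneg F (intervalProj (k.1 n) (k.1 (n + 1)) x))
    (fun n => schreierNorm_nonneg F (intervalProj (k.1 n) (k.1 (n + 1)) y))
    (summable_blocks F hp x k.1 k.2) (summable_blocks F hp y k.1 k.2)
  refine le_trans ?_ (h2.trans (add_le_add (le_ciSup (baernstein_bddAbove F hp x) k)
    (le_ciSup (baernstein_bddAbove F hp y) k)))
  refine Real.rpow_le_rpow (tsum_nonneg fun n => Real.rpow_nonneg (schreierNorm_nonneg F _) _) ?_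
    (by positivity)
  refine (summable_blocks F hp (x + y) k.1 k.2).tsum_le_tsum (fun n => ?_) h1
  refine Real.rpow_le_rpow (schreierNorm_nonneg F _) ?_ (by linarith)
  rw [intervalProj_add]
  exact schreierNorm_add_le F _ _

theorem baernsteinNorm_smul (F : Set (Finset ℕ+)) {p : ℝ} (hp : 1 ≤ p) (c : ℝ) (x : ℕ+ →₀ ℝ) :
    baernsteinNorm F p (c • x) = |c| * baernsteinNorm F p x := by
  rw [baernsteinNorm, baernsteinNorm, Real.mul_iSup_of_nonneg (abs_nonneg c)]
  congr 1
  ext k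
  have h0 : (0 : ℝ) ≤ ∑' n : ℕ, schreierNorm F (intervalProj (k.1 n) (k.1 (n + 1)) x) ^ p :=
    tsum_nonneg fun n => Real.rpow_nonneg (schreierNorm_nonneg F _) _
  simp_rw [intervalProj_smul, schreierNorm_smul,
    Real.mul_rpow (abs_nonneg c) (schreierNorm_nonneg F _)]
  rw [tsum_mul_left, Real.mul_rpow (Real.rpow_nonneg (abs_nonneg c) p) h0,
    ← Real.rpow_mul (abs_nonneg c), mul_one_div_cancel (by linarith : p ≠ 0), Real.rpow_one]

/-- The norm of `(X_F)^{ℓ_p}` on `c₀₀`, as a seminorm. (It is a norm as soon as `F` contains all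
singletons, as the Schreier families do.) -/
def baernsteinSeminorm (F : Set (Finset ℕ+)) (p : ℝ) (hp : 1 ≤ p) : Seminorm ℝ (ℕ+ →₀ ℝ) :=
  Seminorm.of (baernsteinNorm F p) (baernsteinNorm_add_le F hp)
    (fun c x => by rw [Real.norm_eq_abs]; exact baernsteinNorm_smul F hp c x)

/-! ### The Baernstein space -/

/-- A copy of `c₀₀`, to be normed by `baernsteinNorm F p`. -/
def PreSpace (_F : Set (Finset ℕ+)) (p : ℝ) (_hp : 1 ≤ p) : Type := ℕ+ →₀ ℝ

instance (F : Set (Finset ℕ+)) (p : ℝ) (hp : 1 ≤ p) :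
    SeminormedAddCommGroup (PreSpace F p hp) :=
  (baernsteinSeminorm F p hp).toAddGroupSeminorm.toSeminormedAddCommGroup

instance (F : Set (Finset ℕ+)) (p : ℝ) (hp : 1 ≤ p) : NormedSpace ℝ (PreSpace F p hp) where
  toModule := inferInstanceAs (Module ℝ (ℕ+ →₀ ℝ))
  norm_smul_le c x := (baernsteinNorm_smul F hp c x).le

/-- The identity map from `c₀₀` to its normed copy. -/
def PreSpace.of (F : Set (Finset ℕ+)) (p : ℝ) (hp : 1 ≤ p) (x : ℕ+ →₀ ℝ) : PreSpace F p hp := x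

theorem PreSpace.norm_of (F : Set (Finset ℕ+)) (p : ℝ) (hp : 1 ≤ p) (x : ℕ+ →₀ ℝ) :
    ‖PreSpace.of F p hp x‖ = baernsteinNorm F p x := rfl

/-- The completion of `c₀₀` in the norm `baernsteinNorm F p`. For `F = S_α` this is the
Baernstein space `X^p_α` of order `α` and parameter `p`. -/
abbrev Space (F : Set (Finset ℕ+)) (p : ℝ) (hp : 1 ≤ p) : Type :=
  UniformSpace.Completion (PreSpace F p hp)

/-- The unit vectors `eₙ`. -/
def unitVector (F : Set (Finset ℕ+)) (p : ℝ) (hp : 1 ≤ p) (n : ℕ+) : Space F p hp :=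
  ((PreSpace.of F p hp (Finsupp.single n 1) : PreSpace F p hp) : Space F p hp)

/-! ### Bases -/

section Bases

/-- Schauder bases `(eₙ)_{n ≥ 1}`: every `x` is the limit of the partial sums
`∑_{i ≤ n} e_i^*(x) e_i`, with `(e_i^*)` the continuous coordinate functionals. -/
abbrev Basis (X : Type*) [NormedAddCommGroup X] [NormedSpace ℝ X] : Type _ :=
  GeneralSchauderBasis ℕ+ ℝ X (SummationFilter.conditional ℕ+)

variable {X U : Type*} [NormedAddCommGroup X] [NormedSpace ℝ X]
  [NormedAddCommGroup U] [NormedSpace ℝ U]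

/-- `1`-unconditional: changing signs of coefficients does not change the norm. -/
def OneUnconditional (e : ℕ+ → X) : Prop :=
  ∀ (a : ℕ+ →₀ ℝ) (s : ℕ+ → ℝ), (∀ i, |s i| = 1) →
    ‖a.sum fun i t => (s i * t) • e i‖ = ‖a.sum fun i t => t • e i‖

/-- Shrinking: the closed linear span of the coordinate functionals is the whole dual. -/
def Shrinking (b : Basis X) : Prop :=
  (Submodule.span ℝ (Set.range b.coord)).topologicalClosure = ⊤

/-- Boundedly complete: if the partial sums of `∑ cₙ eₙ` are bounded, the series converges. -/
def BoundedlyComplete (b : Basis X) : Prop :=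
  ∀ c : ℕ+ → ℝ, BddAbove (Set.range fun N : ℕ+ => ‖∑ i ∈ Finset.Icc 1 N, c i • b i‖) →
    ∃ x : X, Tendsto (fun N : ℕ+ => ∑ i ∈ Finset.Icc 1 N, c i • b i) atTop (𝓝 x)

/-- `(xₙ)` is `C`-dominated by `(yₙ)`. -/
def DominatedBy (C : ℝ) (x : ℕ → X) (y : ℕ → U) : Prop :=
  ∀ a : ℕ →₀ ℝ, ‖a.sum fun n t => t • x n‖ ≤ C * ‖a.sum fun n t => t • y n‖

/-- `R`-right dominant: `(u_{mₙ})` is `R`-dominated by `(u_{kₙ})` for all subsequences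
`(mₙ)`, `(kₙ)` of the natural numbers with `mₙ ≤ kₙ` for all `n`. -/
def RightDominant (R : ℝ) (u : ℕ+ → X) : Prop :=
  ∀ m k : ℕ → ℕ+, StrictMono m → StrictMono k → (∀ n, m n ≤ k n) →
    DominatedBy R (fun n => u (m n)) (fun n => u (k n))

/-- The support of a vector with respect to a basis. -/
def supp (b : Basis X) (x : X) : Set ℕ+ := {n | b.coord n x ≠ 0}

/-- A normalized block sequence: unit vectors with finite, successive supports. -/
structure IsNormalizedBlockSequence (b : Basis X) (z : ℕ → X) : Prop where
  norm_eq_one : ∀ n, ‖z n‖ = 1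
  finite_supp : ∀ n, (supp b (z n)).Finite
  successive : ∀ n, ∀ i ∈ supp b (z n), ∀ j ∈ supp b (z (n + 1)), i < j

/-- Subsequential `C`-`U`-upper block estimates: every normalized block sequence `(zₙ)` of the
basis `b` is `C`-dominated by `(u_{mₙ})`, where `mₙ = min supp zₙ`. -/
def UpperBlockEstimates (C : ℝ) (b : Basis X) (u : ℕ+ → U) : Prop :=
  ∀ (z : ℕ → X) (m : ℕ → ℕ+), IsNormalizedBlockSequence b z →
    (∀ n, IsLeast (supp b (z n)) (m n)) → DominatedBy C z (fun n => u (m n))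

end Bases

end Baernstein

end

noncomputable section

namespace Baernstein

open Filter Topology

/-! Everything rests on four properties of a family `F`, bundled in `IsRegular`: it is hereditary,
spreading, contains the singletons, and every infinite set carries convex averages that are
uniformly small on `F`. Transfinite induction gives them for every `S_α` with `α < ω₁`. Only the
averages need work: a member of the next family that starts before `K` is covered by at most `K`
members of earlier ones, or lies in one of finitely many earlier families, and
`HasSmallAverages.of_forall_initial` reduces the question to such members.

Spreading drives the block estimates. If `E ∈ F` meets several blocks, the left endpoints of all but
the first of them are a spread of a subset of `E`, so block sums in the Schreier norm cost a factor
`2`. In the Baernstein norm, each interval also meets at most one block that began earlier. These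
leftovers are controlled in `ℓ_p` by the coefficients, hence by the norm of the endpoint vector, and
Minkowski gives `2 + 1 = 3 ≤ 4`. Spreading also gives right dominance, by carrying intervals along
the shift.

For shrinking, suppose that the tails of a functional do not vanish. It is then at least `ε` on a
block sequence in the unit ball. An average of left endpoints that is small in the Schreier norm is
small in the Baernstein norm because `p > 1`; by the block estimate the same average of the blocks
is small too, a contradiction. Bounded completeness follows from the lower `p`-estimate, obtained by
concatenating interval partitions: the `p`-th powers of the norms of the partial sums increase, and
their increments bound the differences. -/

/-- Closure under spreading: if `B` is a finite index set, `u ≤ v` are increasing on `B` and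
`u(B)` belongs to `F`, then so does `v(B)`. -/
def IsSpreading (F : Set (Finset ℕ+)) : Prop :=
  ∀ (B : Finset ℕ) (u v : ℕ → ℕ+), StrictMonoOn u B → StrictMonoOn v B →
    (∀ j ∈ B, u j ≤ v j) → B.image u ∈ F → B.image v ∈ F

/-- Every infinite set carries convex combinations of unit vectors which are uniformly small
on the members of `F`. -/
def HasSmallAverages (F : Set (Finset ℕ+)) : Prop :=
  ∀ M : Set ℕ+, M.Infinite → ∀ ε : ℝ, 0 < ε → ∃ a : ℕ+ →₀ ℝ, (∀ i, 0 ≤ a i) ∧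
    (a.support : Set ℕ+) ⊆ M ∧ ∑ i ∈ a.support, a i = 1 ∧ ∀ E ∈ F, ∑ i ∈ E, a i ≤ ε

/-- The properties of the Schreier families on which the theory of Baernstein spaces rests. -/
structure IsRegular (F : Set (Finset ℕ+)) : Prop where
  hereditary : ∀ E ∈ F, ∀ D ⊆ E, D ∈ F
  spreading : IsSpreading F
  singleton_mem : ∀ i, {i} ∈ F
  small : HasSmallAverages F

/-! ### Block sums in the Schreier norm -/

theorem le_schreierNorm {F : Set (Finset ℕ+)} {E : Finset ℕ+} (hE : E ∈ F) (x : ℕ+ →₀ ℝ) :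
    ∑ i ∈ E, |x i| ≤ schreierNorm F x :=
  le_ciSup (schreier_bddAbove F x) ⟨E, hE⟩

theorem schreierNorm_le_of_forall {F : Set (Finset ℕ+)} {x : ℕ+ →₀ ℝ} {C : ℝ} (hC : 0 ≤ C)
    (h : ∀ E ∈ F, ∑ i ∈ E, |x i| ≤ C) : schreierNorm F x ≤ C :=
  Real.iSup_le (fun E => h E.1 E.2) hC

theorem sum_smul_single_apply {m : ℕ → ℕ+} (hm : StrictMono m) (J : Finset ℕ) (c : ℕ → ℝ)
    {j : ℕ} (hj : j ∈ J) : (∑ l ∈ J, c l • Finsupp.single (m l) (1 : ℝ)) (m j) = c j := by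
  rw [Finsupp.finsetSum_apply, Finset.sum_eq_single j]
  · simp
  · intro l _ hl
    simp [hm.injective.ne hl]
  · exact fun h => absurd hj h

theorem sum_image_abs_sum_smul_single {m : ℕ → ℕ+} (hm : StrictMono m) (J : Finset ℕ)
    (c : ℕ → ℝ) {B : Finset ℕ} (hB : B ⊆ J) :
    ∑ i ∈ B.image m, |(∑ l ∈ J, c l • Finsupp.single (m l) (1 : ℝ)) i| = ∑ j ∈ B, |c j| := by
  rw [Finset.sum_image fun _ _ _ _ h => hm.injective h]
  exact Finset.sum_congr rfl fun j hj => by rw [sum_smul_single_apply hm J c (hB hj)]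

/-- This reindexes an average over the left endpoints `m j` by `j`, so that its coefficients can be
transferred to blocks. -/
theorem exists_finset_eq_sum_smul_single {m : ℕ → ℕ+} (hm : StrictMono m) {b : ℕ+ →₀ ℝ}
    (hb : (b.support : Set ℕ+) ⊆ Set.range m) :
    ∃ J : Finset ℕ, ∑ j ∈ J, b (m j) • Finsupp.single (m j) (1 : ℝ) = b ∧
      ∑ j ∈ J, b (m j) = ∑ i ∈ b.support, b i := by
  classical
  refine ⟨b.support.preimage m hm.injective.injOn, ?_,
    Finset.sum_preimage m _ _ b fun i hi hi' => absurd (hb hi) hi'⟩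
  rw [Finset.sum_preimage m _ _ (fun i => b i • Finsupp.single i (1 : ℝ))
    fun i hi hi' => absurd (hb hi) hi']
  conv_rhs => rw [← Finsupp.sum_single b]
  exact Finset.sum_congr rfl fun i _ => by simp

/-- If `E ∈ F` meets successive blocks starting at `m j`, `j ∈ B`, then the left endpoints of
these blocks other than the first one form a member of `F`. -/
theorem image_erase_min_mem {F : Set (Finset ℕ+)} (hh : ∀ E ∈ F, ∀ D ⊆ E, D ∈ F)
    (hs : IsSpreading F) {m : ℕ → ℕ+} (hm : StrictMono m) {E : Finset ℕ+} (hE : E ∈ F)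
    (B : Finset ℕ) (hB : B.Nonempty) (h : ∀ j ∈ B, ∃ i ∈ E, m j ≤ i ∧ i < m (j + 1)) :
    (B.erase (B.min' hB)).image m ∈ F := by
  classical
  have hlt : ∀ {j k i}, j < k → i < m (j + 1) → i < m k := fun hjk hi =>
    hi.trans_le (hm.monotone hjk)
  have hne : ∀ j ∈ B.erase (B.min' hB), (E.filter (· < m j)).Nonempty := by
    intro j hj
    obtain ⟨i, hi, _, hi2⟩ := h _ (B.min'_mem hB)
    exact ⟨i, Finset.mem_filter.2 ⟨hi, hlt (B.min'_lt_of_mem_erase_min' hB hj) hi2⟩⟩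
  -- `u j` is the last element of `E` before `m j`. For `j < k` in the index set, `E` has a point in
  -- the block of `j`, so `u j < m j ≤ u k`. The first index is erased because `E` need not have a
  -- point before it. The value `1` is never used.
  set u : ℕ → ℕ+ := fun j =>
    if hj : (E.filter (· < m j)).Nonempty then (E.filter (· < m j)).max' hj else 1 with hu
  have humem : ∀ j ∈ B.erase (B.min' hB), u j ∈ E ∧ u j < m j := by
    intro j hj
    have := Finset.max'_mem _ (hne j hj)
    simp only [hu, dif_pos (hne j hj)]
    simpa using! this
  refine hs _ u m ?_ (hm.strictMonoOn _) (fun j hj => (humem j hj).2.le) ?_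
  · intro j hj k hk hjk
    obtain ⟨i, hi, hi1, hi2⟩ := h j (Finset.mem_of_mem_erase hj)
    refine (humem j hj).2.trans_le (hi1.trans ?_)
    simp only [hu, dif_pos (hne k hk)]
    exact Finset.le_max' _ _ (Finset.mem_filter.2 ⟨hi, hlt hjk hi2⟩)
  · refine hh E hE _ fun i hi => ?_
    obtain ⟨j, hj, rfl⟩ := Finset.mem_image.1 hi
    exact (humem j hj).1

/-- Successive blocks in the unit ball of the Schreier norm are `2`-dominated by the unit vectors
at the left endpoints of the blocks. -/
theorem schreierNorm_sum_smul_le {F : Set (Finset ℕ+)} (hh : ∀ E ∈ F, ∀ D ⊆ E, D ∈ F)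
    (hs : IsSpreading F) (h1 : ∀ i, {i} ∈ F) {m : ℕ → ℕ+} (hm : StrictMono m)
    {z : ℕ → ℕ+ →₀ ℝ} (J : Finset ℕ) (c : ℕ → ℝ)
    (hz : ∀ j ∈ J, ∀ i, z j i ≠ 0 → m j ≤ i ∧ i < m (j + 1))
    (hz1 : ∀ j ∈ J, schreierNorm F (z j) ≤ 1) :
    schreierNorm F (∑ j ∈ J, c j • z j) ≤
      2 * schreierNorm F (∑ j ∈ J, c j • Finsupp.single (m j) (1 : ℝ)) := by
  classical
  set y := ∑ j ∈ J, c j • Finsupp.single (m j) (1 : ℝ) with hy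
  have hy0 := schreierNorm_nonneg F y
  refine schreierNorm_le_of_forall (by positivity) fun E hE => ?_
  set B := J.filter fun j => ∃ i ∈ E, z j i ≠ 0 with hBdef
  have hBJ : B ⊆ J := Finset.filter_subset _ _
  have hsum : ∑ i ∈ E, |(∑ j ∈ J, c j • z j) i| ≤ ∑ j ∈ B, |c j| := by
    calc ∑ i ∈ E, |(∑ j ∈ J, c j • z j) i| ≤ ∑ i ∈ E, ∑ j ∈ J, |c j| * |z j i| := by
          refine Finset.sum_le_sum fun i _ => ?_
          rw [Finsupp.finsetSum_apply]
          refine (Finset.abs_sum_le_sum_abs _ _).trans (le_of_eq ?_)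
          exact Finset.sum_congr rfl fun j _ => by simp [abs_mul]
      _ = ∑ j ∈ J, |c j| * ∑ i ∈ E, |z j i| := by
          rw [Finset.sum_comm]
          exact Finset.sum_congr rfl fun j _ => by rw [Finset.mul_sum]
      _ = ∑ j ∈ B, |c j| * ∑ i ∈ E, |z j i| := by
          refine (Finset.sum_subset hBJ fun j hj hjB => ?_).symm
          rw [Finset.sum_eq_zero, mul_zero]
          intro i hi
          by_contra hne
          exact hjB (Finset.mem_filter.2 ⟨hj, i, hi, by simpa using hne⟩)
      _ ≤ ∑ j ∈ B, |c j| := by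
          refine Finset.sum_le_sum fun j hj => ?_
          exact mul_le_of_le_one_right (abs_nonneg _)
            ((le_schreierNorm hE _).trans (hz1 j (hBJ hj)))
  refine hsum.trans ?_
  rcases B.eq_empty_or_nonempty with hB | hB
  · rw [hB]; simpa using hy0
  have hmem := image_erase_min_mem hh hs hm hE B hB fun j hj => by
    obtain ⟨hjJ, i, hi, hne⟩ := Finset.mem_filter.1 hj
    exact ⟨i, hi, hz j hjJ i hne⟩
  -- The two halves of the constant `2`: the endpoints after the first form a member of `F`, and the
  -- first one is a singleton.
  have e1 := le_schreierNorm hmem y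
  rw [hy, sum_image_abs_sum_smul_single hm J c ((Finset.erase_subset _ _).trans hBJ)] at e1
  have e2 := le_schreierNorm (h1 (m (B.min' hB))) y
  rw [Finset.sum_singleton, hy, sum_smul_single_apply hm J c (hBJ (B.min'_mem hB))] at e2
  rw [← Finset.add_sum_erase _ _ (B.min'_mem hB)]
  linarith

/-- Given vectors supported arbitrarily far to the right, one can choose successive ones. -/
theorem exists_successive {P : (ℕ+ →₀ ℝ) → Prop}
    (h : ∀ K : ℕ+, ∃ x : ℕ+ →₀ ℝ, x ≠ 0 ∧ (∀ i, x i ≠ 0 → K ≤ i) ∧ P x) :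
    ∃ (z : ℕ → ℕ+ →₀ ℝ) (m : ℕ → ℕ+), StrictMono m ∧ (∀ j, P (z j)) ∧ (∀ j, z j (m j) ≠ 0) ∧
      ∀ j i, z j i ≠ 0 → m j ≤ i ∧ i < m (j + 1) := by
  classical
  choose g g0 gK gP using h
  have hne : ∀ K, (g K).support.Nonempty := fun K => Finsupp.support_nonempty_iff.2 (g0 K)
  -- `K j` is the threshold for the `j`-th choice: one more than the end of the previous support.
  set K : ℕ → ℕ+ := fun j => Nat.rec 1 (fun _ K => (g K).support.max' (hne K) + 1) j with hKdef
  have hKsucc : ∀ j, K (j + 1) = (g (K j)).support.max' (hne (K j)) + 1 := fun j => rfl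
  set m : ℕ → ℕ+ := fun j => (g (K j)).support.min' (hne (K j)) with hmdef
  have hmmem : ∀ j, m j ∈ (g (K j)).support := fun j => Finset.min'_mem _ _
  have hlt : ∀ j i, g (K j) i ≠ 0 → i < m (j + 1) := by
    intro j i hi
    have e1 : i ≤ (g (K j)).support.max' (hne (K j)) :=
      Finset.le_max' _ _ (Finsupp.mem_support_iff.2 hi)
    have e2 : K (j + 1) ≤ m (j + 1) := gK _ _ (Finsupp.mem_support_iff.1 (hmmem (j + 1)))
    rw [hKsucc] at e2
    exact (PNat.lt_add_one_iff.2 e1).trans_le e2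
  refine ⟨fun j => g (K j), m, strictMono_nat_of_lt_succ fun j =>
    hlt j _ (Finsupp.mem_support_iff.1 (hmmem j)), fun j => gP _,
    fun j => Finsupp.mem_support_iff.1 (hmmem j), fun j i hi => ⟨?_, hlt j i hi⟩⟩
  exact Finset.min'_le _ _ (Finsupp.mem_support_iff.2 hi)

/-! ### Construction of small averages -/

theorem HasSmallAverages.mono {F G : Set (Finset ℕ+)} (hG : HasSmallAverages G) (h : F ⊆ G) :
    HasSmallAverages F := fun M hM ε hε =>
  let ⟨a, a0, aM, a1, aE⟩ := hG M hM ε hε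
  ⟨a, a0, aM, a1, fun E hE => aE E (h hE)⟩

theorem sum_le_sum_support {a : ℕ+ →₀ ℝ} (ha : ∀ i, 0 ≤ a i) (E : Finset ℕ+) :
    ∑ i ∈ E, a i ≤ ∑ i ∈ a.support, a i := by
  simpa [abs_of_nonneg (ha _)] using sum_abs_le E a

theorem sum_support_eq_sum_of_subset {a : ℕ+ →₀ ℝ} {E : Finset ℕ+} (h : a.support ⊆ E) :
    ∑ i ∈ a.support, a i = ∑ i ∈ E, a i :=
  Finset.sum_subset h fun i _ hi => by simpa using hi

theorem infinite_inter_Ici {M : Set ℕ+} (hM : M.Infinite) (K : ℕ+) :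
    (M ∩ Set.Ici K).Infinite := by
  have : M ∩ Set.Ici K = M \ Set.Iio K := by ext i; simp
  rw [this]
  exact hM.sdiff (Set.finite_Iio K)

/-- If for every `K` the members of `F` which start before `K` have small averages, then `F` has
small averages. -/
theorem HasSmallAverages.of_forall_initial {F : Set (Finset ℕ+)}
    (h : ∀ K : ℕ+, HasSmallAverages {E | E ∈ F ∧ ∃ i ∈ E, i ≤ K}) : HasSmallAverages F := by
  classical
  intro M hM ε hε
  -- `w` is a sum of `N` successive averages, each small on the members of `F` that start before the
  -- end of the earlier ones. The first average met by `E` contributes at most `1`, each later one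
  -- at most `ε / 2`.
  have key : ∀ N : ℕ, ∃ w : ℕ+ →₀ ℝ, (∀ i, 0 ≤ w i) ∧ (w.support : Set ℕ+) ⊆ M ∧
      ∑ i ∈ w.support, w i = N ∧ ∀ E ∈ F, ∑ i ∈ E, w i ≤ 1 + N * (ε / 2) := by
    intro N
    induction N with
    | zero => exact ⟨0, by simp, by simp, by simp, fun E _ => by simp⟩
    | succ N ih =>
      obtain ⟨w, w0, wM, w1, wE⟩ := ih
      obtain ⟨K, hK⟩ : ∃ K : ℕ+, ∀ i ∈ w.support, i ≤ K :=
        w.support.exists_le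
      obtain ⟨a, a0, aM, a1, aE⟩ := h K _ (infinite_inter_Ici hM (K + 1)) (ε / 2) (by positivity)
      have hs : ∀ E : Finset ℕ+, ∑ i ∈ E, (w + a) i = ∑ i ∈ E, w i + ∑ i ∈ E, a i := fun E => by
        simp [Finset.sum_add_distrib]
      refine ⟨w + a, fun i => add_nonneg (w0 i) (a0 i), ?_, ?_, fun E hE => ?_⟩
      · intro i hi
        rcases Finset.mem_union.1 (Finsupp.support_add hi) with hi | hi
        · exact wM hi
        · exact (aM hi).1
      · rw [sum_support_eq_sum_of_subset Finsupp.support_add, hs,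
          ← sum_support_eq_sum_of_subset Finset.subset_union_left,
          ← sum_support_eq_sum_of_subset Finset.subset_union_right, w1, a1]
        push_cast; ring
      · rw [hs]
        by_cases hEw : ∃ i ∈ E, w i ≠ 0
        · obtain ⟨i, hi, hwi⟩ := hEw
          have := aE E ⟨hE, i, hi, hK i (Finsupp.mem_support_iff.2 hwi)⟩
          have := wE E hE
          push_cast
          linarith
        · push Not at hEw
          rw [Finset.sum_eq_zero hEw, zero_add]
          refine (sum_le_sum_support a0 E).trans (a1.le.trans ?_)
          have : (0 : ℝ) ≤ ((N + 1 : ℕ) : ℝ) * (ε / 2) := by positivity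
          linarith
  -- After division by `N` the bound is `1 / N + ε / 2`, which is less than `ε`.
  obtain ⟨N, hN⟩ := exists_nat_gt (2 / ε)
  have hN0 : (0 : ℝ) < N := (by positivity : (0 : ℝ) < 2 / ε).trans hN
  obtain ⟨w, w0, wM, w1, wE⟩ := key N
  have hsupp : ((N : ℝ)⁻¹ • w).support = w.support :=
    Finsupp.support_smul_eq (inv_ne_zero hN0.ne')
  refine ⟨(N : ℝ)⁻¹ • w, fun i => mul_nonneg (by positivity) (w0 i), by rwa [hsupp], ?_,
    fun E hE => ?_⟩
  · rw [hsupp]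
    simp only [Finsupp.smul_apply, smul_eq_mul, ← Finset.mul_sum]
    rw [w1, inv_mul_cancel₀ hN0.ne']
  · simp only [Finsupp.smul_apply, smul_eq_mul, ← Finset.mul_sum]
    rw [inv_mul_le_iff₀ hN0]
    have := wE E hE
    rw [div_lt_iff₀ hε] at hN
    linarith

/-- An average of averages: successive `F`-small averages are combined with coefficients that are
`G`-small on their left endpoints. Convexity preserves smallness on `F`, and the factor `2` of the
block estimate in the `G`-norm is absorbed by asking for `ε / 2`. -/
theorem HasSmallAverages.union {F G : Set (Finset ℕ+)} (hF : HasSmallAverages F)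
    (hG : IsRegular G) : HasSmallAverages (F ∪ G) := by
  classical
  intro M hM ε hε
  obtain ⟨z, m, hm, hz, hzm, hzi⟩ := exists_successive (P := fun a => (∀ i, 0 ≤ a i) ∧
    (a.support : Set ℕ+) ⊆ M ∧ ∑ i ∈ a.support, a i = 1 ∧ ∀ E ∈ F, ∑ i ∈ E, a i ≤ ε) (by
      intro K
      obtain ⟨a, a0, aM, a1, aE⟩ := hF _ (infinite_inter_Ici hM K) ε hε
      refine ⟨a, ?_, fun i hi => (aM (Finsupp.mem_support_iff.2 hi)).2, a0,
        fun i hi => (aM hi).1, a1, aE⟩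
      rintro rfl
      simp at a1)
  obtain ⟨b, b0, bM, b1, bE⟩ := hG.small (Set.range m)
    (Set.infinite_range_of_injective hm.injective) (ε / 2) (by positivity)
  obtain ⟨J, hJb, hbsum⟩ := exists_finset_eq_sum_smul_single hm bM
  rw [b1] at hbsum
  set w := ∑ j ∈ J, b (m j) • z j with hw
  have hwi : ∀ i, w i = ∑ j ∈ J, b (m j) * z j i := fun i => by
    simp [hw, Finsupp.finsetSum_apply]
  have hswap : ∀ E : Finset ℕ+, ∑ i ∈ E, w i = ∑ j ∈ J, b (m j) * ∑ i ∈ E, z j i := fun E => by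
    simp only [hwi, Finset.mul_sum]
    exact Finset.sum_comm
  have w0 : ∀ i, 0 ≤ w i := fun i => by
    rw [hwi]
    exact Finset.sum_nonneg fun j _ => mul_nonneg (b0 _) ((hz j).1 i)
  refine ⟨w, w0, ?_, ?_, fun E hE => ?_⟩
  · intro i hi
    obtain ⟨j, _, hj⟩ : ∃ j ∈ J, b (m j) * z j i ≠ 0 :=
      Finset.exists_ne_zero_of_sum_ne_zero (by rw [← hwi]; exact Finsupp.mem_support_iff.1 hi)
    exact (hz j).2.1 (Finsupp.mem_support_iff.2 (right_ne_zero_of_mul hj))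
  -- A common finite set carrying `w` and all the blocks, over which the order of summation can be
  -- exchanged.
  · set D := w.support ∪ J.biUnion fun j => (z j).support
    rw [sum_support_eq_sum_of_subset (E := D) Finset.subset_union_left, hswap, ← hbsum]
    refine Finset.sum_congr rfl fun j hj => ?_
    rw [← sum_support_eq_sum_of_subset (E := D), (hz j).2.2.1, mul_one]
    exact (Finset.subset_biUnion_of_mem (fun j => (z j).support) hj).trans
      Finset.subset_union_right
  · rcases hE with hE | hE
    · rw [hswap]
      calc _ ≤ ∑ j ∈ J, b (m j) * ε :=
            Finset.sum_le_sum fun j _ => mul_le_mul_of_nonneg_left ((hz j).2.2.2 E hE) (b0 _)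
        _ = ε := by rw [← Finset.sum_mul, hbsum, one_mul]
    · have e1 := schreierNorm_sum_smul_le hG.hereditary hG.spreading hG.singleton_mem hm J
        (fun j => b (m j)) (fun j _ => hzi j) fun j _ => schreierNorm_le_of_forall zero_le_one
          fun E _ => by
            simp only [abs_of_nonneg ((hz j).1 _)]
            exact (sum_le_sum_support (hz j).1 E).trans_eq (hz j).2.2.1
      have e3 : schreierNorm G b ≤ ε / 2 := schreierNorm_le_of_forall (by positivity)
        fun E hE => by simpa [abs_of_nonneg (b0 _)] using bE E hE
      have e4 := le_schreierNorm hE w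
      simp only [abs_of_nonneg (w0 _)] at e4
      rw [hJb] at e1
      linarith

theorem HasSmallAverages.biUnion {F : ℕ+ → Set (Finset ℕ+)} (hF : ∀ n, IsRegular (F n))
    (s : Finset ℕ+) : HasSmallAverages (⋃ n ∈ s, F n) := by
  classical
  induction s using Finset.induction_on with
  | empty => exact (hF 1).small.mono (by simp)
  | insert n s _ ih =>
    refine (ih.union (hF n)).mono ?_
    rw [Finset.set_biUnion_insert, Set.union_comm]

/-! ### Regularity of the Schreier families -/

theorem isRegular_zero : IsRegular {E : Finset ℕ+ | E.card ≤ 1} where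
  hereditary E hE D hD := (Finset.card_le_card hD).trans hE
  spreading B u v hu hv _ h := by
    have h' : (B.image u).card ≤ 1 := h
    rw [Finset.card_image_of_injOn hu.injOn] at h'
    exact Finset.card_image_le.trans h'
  singleton_mem i := by simp
  small := by
    classical
    intro M hM ε hε
    -- The average is uniform over `N` points, with weights `1 / N < ε`.
    obtain ⟨N, hN⟩ := exists_nat_gt (1 / ε)
    have hN0 : (0 : ℝ) < N := (by positivity : (0 : ℝ) < 1 / ε).trans hN
    obtain ⟨t, htM, ht⟩ := hM.exists_subset_card_eq N
    have happ : ∀ i, Finsupp.indicator t (fun _ _ => (N : ℝ)⁻¹) i =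
        if i ∈ t then (N : ℝ)⁻¹ else 0 := fun i => by simp [Finsupp.indicator_apply]
    have hsub : (Finsupp.indicator t (fun _ _ => (N : ℝ)⁻¹)).support ⊆ t :=
      Finsupp.support_indicator_subset t _
    refine ⟨Finsupp.indicator t fun _ _ => (N : ℝ)⁻¹, fun i => ?_,
      (Finset.coe_subset.2 hsub).trans htM, ?_, fun E hE => ?_⟩
    · rw [happ]; split_ifs <;> positivity
    · rw [sum_support_eq_sum_of_subset hsub, Finset.sum_congr rfl fun i hi => by
        rw [happ, if_pos hi]]
      rw [Finset.sum_const, ht, nsmul_eq_mul, mul_inv_cancel₀ hN0.ne']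
    · have hle : ∀ i, Finsupp.indicator t (fun _ _ => (N : ℝ)⁻¹) i ≤ ε := fun i => by
        rw [happ]
        split_ifs
        · rw [inv_le_comm₀ hN0 hε]; simpa using hN.le
        · exact hε.le
      calc _ ≤ E.card • ε := Finset.sum_le_card_nsmul _ _ _ fun i _ => hle i
        _ ≤ 1 • ε := nsmul_le_nsmul_left hε.le hE
        _ = ε := one_nsmul ε

/-- Passing to a subset or spreading keeps the number `n` of pieces and can only increase the
minimum; pieces may become empty, which the definition allows. A member that starts at or before `K`
has at most `K` pieces, so an average that is `ε / K`-small on `S` suffices. -/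
theorem isRegular_schreierSucc {S : Set (Finset ℕ+)} (hS : IsRegular S) :
    IsRegular (schreierSucc S) where
  hereditary := by
    classical
    rintro E ⟨n, D, hD, hlt, hn, rfl⟩ E' hE'
    refine ⟨n, fun k => D k ∩ E', fun k => hS.hereditary _ (hD k) _ Finset.inter_subset_left,
      fun k l hkl i hi j hj => hlt k l hkl i (Finset.mem_inter.1 hi).1 j (Finset.mem_inter.1 hj).1,
      fun i hi => hn i (hE' hi), ?_⟩
    ext i
    have := @hE' i
    simp at this ⊢
    tauto
  spreading := by
    classical
    rintro B u v hu hv huv ⟨n, D, hD, hlt, hn, hE⟩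
    have hmem : ∀ j ∈ B, ∃ k, u j ∈ D k := fun j hj => by
      have : u j ∈ B.image u := Finset.mem_image_of_mem u hj
      rw [hE] at this
      simpa using! this
    refine ⟨n, fun k => (B.filter fun j => u j ∈ D k).image v, fun k => ?_, ?_, ?_, ?_⟩
    · refine hS.spreading _ u v (hu.mono ?_) (hv.mono ?_) (fun j hj => huv j ?_)
        (hS.hereditary _ (hD k) _ ?_)
      · exact Finset.coe_subset.2 (Finset.filter_subset _ _)
      · exact Finset.coe_subset.2 (Finset.filter_subset _ _)
      · exact (Finset.mem_filter.1 hj).1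
      · intro i hi
        obtain ⟨j, hj, rfl⟩ := Finset.mem_image.1 hi
        exact (Finset.mem_filter.1 hj).2
    · intro k l hkl i hi i' hi'
      obtain ⟨j, hj, rfl⟩ := Finset.mem_image.1 hi
      obtain ⟨j', hj', rfl⟩ := Finset.mem_image.1 hi'
      rw [Finset.mem_filter] at hj hj'
      exact hv hj.1 hj'.1 ((hu.lt_iff_lt hj.1 hj'.1).1 (hlt k l hkl _ hj.2 _ hj'.2))
    · intro i hi
      obtain ⟨j, hj, rfl⟩ := Finset.mem_image.1 hi
      exact (hn (u j) (Finset.mem_image_of_mem u hj)).trans (huv j hj)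
    · ext i
      simp only [Finset.mem_image, Finset.mem_biUnion, Finset.mem_univ, true_and,
        Finset.mem_filter]
      constructor
      · rintro ⟨j, hj, rfl⟩
        obtain ⟨k, hk⟩ := hmem j hj
        exact ⟨k, j, ⟨hj, hk⟩, rfl⟩
      · rintro ⟨k, j, ⟨hj, _⟩, rfl⟩
        exact ⟨j, hj, rfl⟩
  singleton_mem i := ⟨1, fun _ => {i}, fun _ => hS.singleton_mem i,
    fun k l hkl => absurd hkl (by simp [Subsingleton.elim k l]), fun j _ => j.pos, by simp⟩
  small := by
    classical
    refine HasSmallAverages.of_forall_initial fun K M hM ε hε => ?_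
    have hK : (0 : ℝ) < (K : ℕ) := by exact_mod_cast K.pos
    obtain ⟨a, a0, aM, a1, aE⟩ := hS.small M hM (ε / (K : ℕ)) (by positivity)
    refine ⟨a, a0, aM, a1, ?_⟩
    rintro _ ⟨⟨n, D, hD, hlt, hn, rfl⟩, i, hi, hiK⟩
    have hnK : n ≤ (K : ℕ) := (hn i hi).trans hiK
    have hdisj : Set.PairwiseDisjoint (Finset.univ : Finset (Fin n)) D := by
      intro k _ l _ hkl
      refine Finset.disjoint_left.2 fun j hj hj' => ?_
      rcases lt_or_gt_of_ne hkl with h | h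
      · exact lt_irrefl _ (hlt k l h j hj j hj')
      · exact lt_irrefl _ (hlt l k h j hj' j hj)
    calc _ = ∑ k, ∑ i ∈ D k, a i := Finset.sum_biUnion hdisj
      _ ≤ ∑ _k : Fin n, ε / (K : ℕ) := Finset.sum_le_sum fun k _ => aE _ (hD k)
      _ = n * (ε / (K : ℕ)) := by simp
      _ ≤ (K : ℕ) * (ε / (K : ℕ)) := by gcongr
      _ = ε := by field_simp

/-- A member that starts at or before `K` belongs to some `F n` with `n ≤ K`, so only finitely many
families matter at a time. -/
theorem isRegular_limit {F : ℕ+ → Set (Finset ℕ+)} (hF : ∀ n, IsRegular (F n)) :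
    IsRegular {E | ∃ n : ℕ+, (∀ i ∈ E, n ≤ i) ∧ E ∈ F n} where
  hereditary := by
    rintro E ⟨n, hn, hE⟩ D hD
    exact ⟨n, fun i hi => hn i (hD hi), (hF n).hereditary E hE D hD⟩
  spreading := by
    rintro B u v hu hv huv ⟨n, hn, hE⟩
    refine ⟨n, fun i hi => ?_, (hF n).spreading B u v hu hv huv hE⟩
    obtain ⟨j, hj, rfl⟩ := Finset.mem_image.1 hi
    exact (hn _ (Finset.mem_image_of_mem u hj)).trans (huv j hj)
  singleton_mem i := ⟨1, fun j _ => one_le, (hF 1).singleton_mem i⟩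
  small := by
    refine HasSmallAverages.of_forall_initial fun K => ?_
    refine (HasSmallAverages.biUnion hF (Finset.Iic K)).mono ?_
    rintro E ⟨⟨n, hn, hE⟩, i, hi, hiK⟩
    exact Set.mem_biUnion (by simpa using (hn i hi).trans hiK) hE

theorem isRegular_schreierFamily {a : Ordinal.{0} → ℕ+ → Ordinal.{0}} (ha : IsLimitSystem a)
    (α : Ordinal.{0}) (hα : α < Ordinal.omega 1) : IsRegular (schreierFamily a α) := by
  induction α using Ordinal.limitRecOn with
  | zero => rw [schreierFamily_zero]; exact isRegular_zero
  | add_one α ih =>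
    rw [schreierFamily_add_one]
    exact isRegular_schreierSucc (ih ((lt_add_one α).trans hα))
  | limit l hl ih =>
    rw [schreierFamily_limit a ha l hl hα]
    refine isRegular_limit fun n => ?_
    obtain ⟨h1, h2⟩ := ha l hα hl
    -- Since `a l n < a l (n + 1) ≤ l` and `l` is a limit, the induction hypothesis applies at `a l
    -- n + 1`.
    have h3 : a l n + 1 < l :=
      hl.add_one_lt ((h1 (PNat.lt_add_right n 1)).trans_le (h2.1 ⟨n + 1, rfl⟩))
    exact ih _ h3 (h3.trans hα)

/-! ### The Baernstein norm on `c₀₀` -/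

theorem schreierNorm_mono {F : Set (Finset ℕ+)} {x y : ℕ+ →₀ ℝ} (h : ∀ i, |x i| ≤ |y i|) :
    schreierNorm F x ≤ schreierNorm F y :=
  schreierNorm_le_of_forall (schreierNorm_nonneg F y) fun _ hE =>
    (Finset.sum_le_sum fun i _ => h i).trans (le_schreierNorm hE y)

theorem intervalProj_apply (m n : ℕ+) (x : ℕ+ →₀ ℝ) (i : ℕ+) :
    intervalProj m n x i = if m ≤ i ∧ i < n then x i else 0 := by
  rw [intervalProj, Finsupp.filter_apply]

theorem abs_intervalProj_apply_le (m n : ℕ+) (x : ℕ+ →₀ ℝ) (i : ℕ+) :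
    |intervalProj m n x i| ≤ |x i| := by
  rw [intervalProj_apply]
  split_ifs <;> simp

theorem intervalProj_sum_smul (m n : ℕ+) (J : Finset ℕ) (c : ℕ → ℝ) (z : ℕ → ℕ+ →₀ ℝ) :
    intervalProj m n (∑ j ∈ J, c j • z j) = ∑ j ∈ J, c j • intervalProj m n (z j) := by
  ext i
  rw [intervalProj_apply, Finsupp.finsetSum_apply, Finsupp.finsetSum_apply]
  simp only [Finsupp.smul_apply, intervalProj_apply]
  split_ifs <;> simp

theorem intervalProj_self (m : ℕ+) (x : ℕ+ →₀ ℝ) : intervalProj m m x = 0 := by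
  ext i
  rw [intervalProj_apply, if_neg (fun h => absurd h.1 (not_le.2 h.2))]
  rfl

variable {F : Set (Finset ℕ+)} {p : ℝ}

theorem sum_rpow_le_of_strictMono (hp : 1 ≤ p) (x : ℕ+ →₀ ℝ) {k : ℕ → ℕ+} (hk : StrictMono k)
    (T : ℕ) : ∑ t ∈ Finset.range T, schreierNorm F (intervalProj (k t) (k (t + 1)) x) ^ p ≤
      baernsteinNorm F p x ^ p := by
  have hp0 : 0 < p := by linarith
  have h0 : ∀ t, 0 ≤ schreierNorm F (intervalProj (k t) (k (t + 1)) x) ^ p := fun t =>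
    Real.rpow_nonneg (schreierNorm_nonneg F _) _
  refine ((summable_blocks F hp x k hk).sum_le_tsum _ fun t _ => h0 t).trans ?_
  rw [← Real.rpow_inv_le_iff_of_pos (tsum_nonneg h0) (baernsteinNorm_nonneg F p x) hp0,
    ← one_div]
  exact le_ciSup (baernstein_bddAbove F hp x) ⟨k, hk⟩

theorem baernsteinNorm_le_of_forall (hp : 1 ≤ p) {x : ℕ+ →₀ ℝ} {C : ℝ} (hC : 0 ≤ C)
    (h : ∀ k : ℕ → ℕ+, StrictMono k → ∀ T : ℕ,
      ∑ t ∈ Finset.range T, schreierNorm F (intervalProj (k t) (k (t + 1)) x) ^ p ≤ C ^ p) :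
    baernsteinNorm F p x ≤ C := by
  refine Real.iSup_le (fun k => ?_) hC
  have h0 : ∀ t, 0 ≤ schreierNorm F (intervalProj (k.1 t) (k.1 (t + 1)) x) ^ p := fun t =>
    Real.rpow_nonneg (schreierNorm_nonneg F _) _
  rw [one_div, Real.rpow_inv_le_iff_of_pos (tsum_nonneg h0) hC (by linarith)]
  exact Real.tsum_le_of_sum_range_le h0 (h k.1 k.2)

theorem baernsteinNorm_rpow_le_of_forall (hp : 1 ≤ p) {x : ℕ+ →₀ ℝ} {C : ℝ}
    (h : ∀ k : ℕ → ℕ+, StrictMono k → ∀ T : ℕ,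
      ∑ t ∈ Finset.range T, schreierNorm F (intervalProj (k t) (k (t + 1)) x) ^ p ≤ C) :
    baernsteinNorm F p x ^ p ≤ C := by
  -- The empty sum, `T = 0`, along any admissible sequence gives the sign of `C`. Below, `C` is a
  -- difference whose sign is not known beforehand.
  have hC : 0 ≤ C := by
    simpa using h (fun n => n.succPNat) (fun a b hab => Nat.succPNat_lt_succPNat.2 hab) 0
  rw [← Real.le_rpow_inv_iff_of_pos (baernsteinNorm_nonneg F p x) hC (by linarith)]
  refine baernsteinNorm_le_of_forall hp (by positivity) fun k hk T => ?_
  rw [Real.rpow_inv_rpow hC (by linarith)]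
  exact h k hk T

theorem baernsteinNorm_mono (hp : 1 ≤ p) {x y : ℕ+ →₀ ℝ} (h : ∀ i, |x i| ≤ |y i|) :
    baernsteinNorm F p x ≤ baernsteinNorm F p y :=
  baernsteinNorm_le_of_forall hp (baernsteinNorm_nonneg F p y) fun k hk T => by
    refine (Finset.sum_le_sum fun t _ => ?_).trans (sum_rpow_le_of_strictMono hp y hk T)
    refine Real.rpow_le_rpow (schreierNorm_nonneg F _) (schreierNorm_mono fun i => ?_)
      (by linarith)
    rw [intervalProj_apply, intervalProj_apply]
    split_ifs
    · exact h i
    · exact le_rfl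

/-- The empty intervals of an increasing sequence of endpoints may be dropped. -/
theorem exists_strictMono_sum_eq {g : ℕ+ → ℕ+ → ℝ} (hg : ∀ i, g i i = 0) {k : ℕ → ℕ+}
    (hk : Monotone k) (T : ℕ) : ∃ (l : ℕ → ℕ+) (U : ℕ), StrictMono l ∧ l U = k T ∧
      ∑ t ∈ Finset.range T, g (k t) (k (t + 1)) =
        ∑ t ∈ Finset.range U, g (l t) (l (t + 1)) := by
  induction T with
  | zero =>
    -- Only the endpoints up to index `U` matter; beyond it the sequence continues in unit steps.
    exact ⟨fun n => ((k 0).natPred + n).succPNat, 0,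
      fun a b hab => Nat.succPNat_lt_succPNat.2 (by omega), by simp, by simp⟩
  | succ T ih =>
    obtain ⟨l, U, hl, hlU, hsum⟩ := ih
    rcases (hk T.le_succ).eq_or_lt with h | h
    · exact ⟨l, U, hl, hlU.trans h, by rw [Finset.sum_range_succ, hsum, ← h, hg, add_zero]⟩
    · set l' : ℕ → ℕ+ := fun t =>
        if t ≤ U then l t else ((k (T + 1)).natPred + (t - (U + 1))).succPNat
        with hl'
      have hle : ∀ t, t ≤ U → l' t = l t := fun t ht => if_pos ht
      have hU : l' (U + 1) = k (T + 1) := by simp [hl']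
      refine ⟨l', U + 1, strictMono_nat_of_lt_succ fun t => ?_, hU, ?_⟩
      · rcases lt_trichotomy t U with ht | rfl | ht
        · rw [hle t ht.le, hle (t + 1) ht]
          exact hl t.lt_succ_self
        · rw [hU, hle t le_rfl, hlU]
          exact h
        · simp only [hl', if_neg (not_le.2 ht), if_neg (not_le.2 (ht.trans t.lt_succ_self))]
          exact Nat.succPNat_lt_succPNat.2 (by omega)
      · rw [Finset.sum_range_succ, Finset.sum_range_succ, hsum, hU, hle U le_rfl, hlU]
        congr 1
        refine Finset.sum_congr rfl fun t ht => ?_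
        have ht := Finset.mem_range.1 ht
        rw [hle t ht.le, hle (t + 1) ht]

/-- Truncated or shifted partitions may have repeated endpoints; this form lets them be used
directly. -/
theorem sum_rpow_le_of_monotone (hp : 1 ≤ p) (x : ℕ+ →₀ ℝ) {k : ℕ → ℕ+} (hk : Monotone k)
    (T : ℕ) : ∑ t ∈ Finset.range T, schreierNorm F (intervalProj (k t) (k (t + 1)) x) ^ p ≤
      baernsteinNorm F p x ^ p := by
  obtain ⟨l, U, hl, _, h⟩ := exists_strictMono_sum_eq
    (g := fun m n => schreierNorm F (intervalProj m n x) ^ p)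
    (fun i => by rw [intervalProj_self, schreierNorm_zero, Real.zero_rpow (by linarith)]) hk T
  rw [h]
  exact sum_rpow_le_of_strictMono hp x hl U

theorem schreierNorm_le_baernsteinNorm (hp : 1 ≤ p) (x : ℕ+ →₀ ℝ) :
    schreierNorm F x ≤ baernsteinNorm F p x := by
  obtain ⟨K, hK⟩ : ∃ K : ℕ+, ∀ i ∈ x.support, i ≤ K := x.support.exists_le
  -- A single interval `[1, K + 1)` that contains the whole support.
  have h := sum_rpow_le_of_monotone (F := F) hp x (k := fun t => if t = 0 then 1 else K + 1)
    (monotone_nat_of_le_succ fun t => by by_cases h : t = 0 <;> simp [h]) 1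
  have hx : intervalProj 1 (K + 1) x = x := by
    ext i
    rw [intervalProj_apply]
    split_ifs with hi
    · rfl
    · by_contra hne
      exact hi ⟨one_le, PNat.lt_add_one_iff.2 (hK i (Finsupp.mem_support_iff.2 (Ne.symm hne)))⟩
  simp only [Finset.range_one, Finset.sum_singleton, if_true, zero_add, one_ne_zero, if_false,
    hx] at h
  exact (Real.rpow_le_rpow_iff (schreierNorm_nonneg F x) (baernsteinNorm_nonneg F p x)
    (by linarith)).1 h

theorem abs_apply_le_baernsteinNorm (h1 : ∀ i, {i} ∈ F) (hp : 1 ≤ p) (x : ℕ+ →₀ ℝ) (i : ℕ+) :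
    |x i| ≤ baernsteinNorm F p x := by
  simpa using (le_schreierNorm (h1 i) x).trans (schreierNorm_le_baernsteinNorm hp x)

/-- The Baernstein norm satisfies a lower `p`-estimate. -/
theorem baernsteinNorm_rpow_add_le (hp : 1 ≤ p) {x y : ℕ+ →₀ ℝ} {m : ℕ+}
    (hx : ∀ i, x i ≠ 0 → i < m) (hy : ∀ i, y i ≠ 0 → m ≤ i) :
    baernsteinNorm F p x ^ p + baernsteinNorm F p y ^ p ≤ baernsteinNorm F p (x + y) ^ p := by
  rw [← le_sub_iff_add_le]
  refine baernsteinNorm_rpow_le_of_forall hp fun k hk T => ?_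
  rw [le_sub_iff_add_le, ← le_sub_iff_add_le']
  refine baernsteinNorm_rpow_le_of_forall hp fun l hl U => ?_
  rw [le_sub_iff_add_le']
  -- The partition for `x` cut off above at `m`, followed by the partition for `y` cut off below at
  -- `m`. The interval from index `T` to `T + 1` joins the two, and its nonnegative contribution is
  -- discarded.
  set r : ℕ → ℕ+ := fun t => if t ≤ T then min (k t) m else max (l (t - (T + 1))) m with hr
  have hrm : Monotone r := by
    refine monotone_nat_of_le_succ fun t => ?_
    rcases lt_trichotomy t T with ht | rfl | ht
    · simp only [hr, if_pos ht.le, if_pos (Nat.succ_le_of_lt ht)]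
      exact min_le_min_right _ (hk.monotone t.le_succ)
    · simp [hr]
    · simp only [hr, if_neg (not_le.2 ht), if_neg (not_le.2 (ht.trans t.lt_succ_self))]
      exact max_le_max_right _ (hl.monotone (by omega))
  refine le_trans ?_ (sum_rpow_le_of_monotone hp (x + y) hrm (T + 1 + U))
  have h0 : ∀ t, 0 ≤ schreierNorm F (intervalProj (r t) (r (t + 1)) (x + y)) ^ p := fun t =>
    Real.rpow_nonneg (schreierNorm_nonneg F _) _
  rw [Finset.sum_range_add, Finset.sum_range_succ]
  have e1 : ∀ t ∈ Finset.range T, schreierNorm F (intervalProj (k t) (k (t + 1)) x) ^ p ≤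
      schreierNorm F (intervalProj (r t) (r (t + 1)) (x + y)) ^ p := fun t ht => by
    have ht := Finset.mem_range.1 ht
    refine Real.rpow_le_rpow (schreierNorm_nonneg F _) (schreierNorm_mono fun i => ?_)
      (by linarith)
    simp only [hr, if_pos ht.le, if_pos (Nat.succ_le_of_lt ht), intervalProj_apply]
    by_cases hxi : x i = 0
    · simp [hxi]
    · have him := hx i hxi
      have : y i = 0 := by_contra fun h => absurd (hy i h) (not_le.2 him)
      simp only [Finsupp.add_apply, this, add_zero]
      by_cases hi : k t ≤ i ∧ i < k (t + 1)
      · rw [if_pos hi, if_pos ⟨(min_le_left _ _).trans hi.1, lt_min hi.2 him⟩]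
      · rw [if_neg hi]; simp
  have e2 : ∀ t ∈ Finset.range U, schreierNorm F (intervalProj (l t) (l (t + 1)) y) ^ p ≤
      schreierNorm F (intervalProj (r (T + 1 + t)) (r (T + 1 + t + 1)) (x + y)) ^ p :=
    fun t _ => by
    refine Real.rpow_le_rpow (schreierNorm_nonneg F _) (schreierNorm_mono fun i => ?_)
      (by linarith)
    have r1 : r (T + 1 + t) = max (l t) m := by simp [hr]; omega
    have r2 : r (T + 1 + t + 1) = max (l (t + 1)) m := by
      simp only [hr, if_neg (show ¬ T + 1 + t + 1 ≤ T by omega)]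
      congr 2; omega
    rw [r1, r2, intervalProj_apply, intervalProj_apply]
    by_cases hyi : y i = 0
    · simp [hyi]
    · have him := hy i hyi
      have : x i = 0 := by_contra fun h => absurd (hx i h) (not_lt.2 him)
      simp only [Finsupp.add_apply, this, zero_add]
      by_cases hi : l t ≤ i ∧ i < l (t + 1)
      · rw [if_pos hi, if_pos ⟨max_le hi.1 him, hi.2.trans_le (le_max_left _ _)⟩]
      · rw [if_neg hi]; simp
  have := Finset.sum_le_sum e1
  have := Finset.sum_le_sum e2
  have := h0 T
  linarith

/-- The intervals of a partition are disjoint, so at most one of them contains `n`. -/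
theorem baernsteinNorm_single (h1 : ∀ i, {i} ∈ F) (hp : 1 ≤ p) (n : ℕ+) :
    baernsteinNorm F p (Finsupp.single n 1) = 1 := by
  classical
  refine le_antisymm ?_ (by simpa using abs_apply_le_baernsteinNorm h1 hp (Finsupp.single n 1) n)
  refine baernsteinNorm_le_of_forall hp zero_le_one fun k hk T => ?_
  rw [Real.one_rpow]
  have hN : ∀ t, schreierNorm F (intervalProj (k t) (k (t + 1)) (Finsupp.single n 1)) ≤
      if k t ≤ n ∧ n < k (t + 1) then 1 else 0 := fun t => by
    refine schreierNorm_le_of_forall (by split_ifs <;> simp) fun E _ => ?_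
    have : ∀ i, |intervalProj (k t) (k (t + 1)) (Finsupp.single n 1) i| =
        if i = n then (if k t ≤ n ∧ n < k (t + 1) then 1 else 0) else 0 := fun i => by
      rw [intervalProj_apply, Finsupp.single_apply]
      by_cases h : n = i
      · subst h; split_ifs <;> simp
      · simp [h, Ne.symm h]
    simp only [this, Finset.sum_ite_eq']
    split_ifs <;> simp
  by_cases h : ∃ s, k s ≤ n ∧ n < k (s + 1)
  · obtain ⟨s, hs⟩ := h
    have hz : ∀ t, t ≠ s → schreierNorm F (intervalProj (k t) (k (t + 1))
        (Finsupp.single n 1)) = 0 := fun t ht => by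
      refine le_antisymm ((hN t).trans_eq (if_neg fun h' => ht ?_)) (schreierNorm_nonneg F _)
      have a1 := hk.lt_iff_lt.1 (h'.1.trans_lt hs.2)
      have a2 := hk.lt_iff_lt.1 (hs.1.trans_lt h'.2)
      omega
    calc _ ≤ ∑ t ∈ Finset.range T, if t = s then (1 : ℝ) else 0 := by
          refine Finset.sum_le_sum fun t _ => ?_
          by_cases ht : t = s
          · rw [if_pos ht]
            refine Real.rpow_le_one (schreierNorm_nonneg F _) ((hN t).trans ?_) (by linarith)
            split_ifs <;> simp
          · rw [hz t ht, if_neg ht, Real.zero_rpow (by linarith)]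
      _ ≤ 1 := by
          rw [Finset.sum_ite_eq']
          split_ifs <;> simp
  · push Not at h
    refine (Finset.sum_nonpos fun t _ => ?_).trans zero_le_one
    have : schreierNorm F (intervalProj (k t) (k (t + 1)) (Finsupp.single n 1)) = 0 :=
      le_antisymm ((hN t).trans_eq (if_neg fun h' => absurd h'.2 (not_lt.2 (h t h'.1))))
        (schreierNorm_nonneg F _)
    rw [this, Real.zero_rpow (by linarith)]

/-! ### Block estimates and right shifts in the Baernstein norm -/

theorem intervalProj_sum_smul_single (k l : ℕ+) (m : ℕ → ℕ+) (J : Finset ℕ) (c : ℕ → ℝ) :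
    intervalProj k l (∑ j ∈ J, c j • Finsupp.single (m j) (1 : ℝ)) =
      ∑ j ∈ J with k ≤ m j ∧ m j < l, c j • Finsupp.single (m j) (1 : ℝ) := by
  rw [intervalProj_sum_smul, Finset.sum_filter]
  refine Finset.sum_congr rfl fun j _ => ?_
  split_ifs with h
  · congr 1
    ext i
    rw [intervalProj_apply]
    split_ifs with hi
    · rfl
    · exact (Finsupp.single_eq_of_ne (by rintro rfl; exact hi h)).symm
  · convert smul_zero (c j)
    ext i
    rw [intervalProj_apply]
    split_ifs with hi
    · exact Finsupp.single_eq_of_ne (by rintro rfl; exact h hi)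
    · rfl

/-- The points `m j` themselves serve as interval endpoints, and in each interval the singleton `{m
j}` is tested. -/
theorem sum_abs_rpow_le (h1 : ∀ i, {i} ∈ F) (hp : 1 ≤ p) {m : ℕ → ℕ+} (hm : StrictMono m)
    (J : Finset ℕ) (c : ℕ → ℝ) : ∑ j ∈ J, |c j| ^ p ≤
      baernsteinNorm F p (∑ j ∈ J, c j • Finsupp.single (m j) (1 : ℝ)) ^ p := by
  obtain ⟨T, hT⟩ : ∃ T, J ⊆ Finset.range T := ⟨_, Finset.subset_range_sup_succ J⟩
  refine le_trans ?_ (sum_rpow_le_of_strictMono hp _ hm T)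
  refine le_trans ?_ (Finset.sum_le_sum_of_subset_of_nonneg hT fun t _ _ =>
    Real.rpow_nonneg (schreierNorm_nonneg F _) _)
  refine Finset.sum_le_sum fun j hj => Real.rpow_le_rpow (abs_nonneg _) ?_ (by linarith)
  refine le_trans (le_of_eq ?_) (le_schreierNorm (h1 (m j)) _)
  rw [Finset.sum_singleton, intervalProj_apply, if_pos ⟨le_rfl, hm j.lt_succ_self⟩,
    sum_smul_single_apply hm J c hj]

/-- Successive blocks in the unit ball of the Baernstein norm are `3`-dominated by the unit
vectors at the left endpoints of the blocks. -/
theorem baernsteinNorm_sum_smul_le (hF : IsRegular F) (hp : 1 ≤ p) {m : ℕ → ℕ+}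
    (hm : StrictMono m) {z : ℕ → ℕ+ →₀ ℝ} (J : Finset ℕ) (c : ℕ → ℝ)
    (hz : ∀ j ∈ J, ∀ i, z j i ≠ 0 → m j ≤ i ∧ i < m (j + 1))
    (hz1 : ∀ j ∈ J, baernsteinNorm F p (z j) ≤ 1) :
    baernsteinNorm F p (∑ j ∈ J, c j • z j) ≤
      3 * baernsteinNorm F p (∑ j ∈ J, c j • Finsupp.single (m j) (1 : ℝ)) := by
  have hp0 : 0 < p := by linarith
  set y := ∑ j ∈ J, c j • Finsupp.single (m j) (1 : ℝ) with hy
  have hy0 : 0 ≤ baernsteinNorm F p y := baernsteinNorm_nonneg F p y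
  refine baernsteinNorm_le_of_forall hp (by positivity) fun k hk T => ?_
  set P : ℕ → (ℕ+ →₀ ℝ) → ℕ+ →₀ ℝ := fun t x => intervalProj (k t) (k (t + 1)) x with hP
  have hPz : ∀ t j, P t (z j) ≠ 0 → ∃ i, z j i ≠ 0 ∧ k t ≤ i ∧ i < k (t + 1) := by
    intro t j hne
    obtain ⟨i, hi⟩ := Finsupp.ne_iff.1 hne
    simp only [hP, intervalProj_apply] at hi
    by_cases h : k t ≤ i ∧ i < k (t + 1)
    · rw [if_pos h] at hi
      exact ⟨i, hi, h⟩
    · rw [if_neg h] at hi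
      exact absurd rfl hi
  -- For the `t`-th interval, `J₁ t` indexes the blocks that begin inside it and `J₂ t` those that
  -- begin before it. Blocks that begin after it do not meet it.
  set J₁ : ℕ → Finset ℕ := fun t => J.filter fun j => k t ≤ m j ∧ m j < k (t + 1) with hJ₁
  set J₂ : ℕ → Finset ℕ := fun t => J.filter fun j => m j < k t with hJ₂
  set q : ℕ → ℝ := fun t => schreierNorm F (∑ j ∈ J₂ t, c j • P t (z j)) with hq
  have hq0 : ∀ t, 0 ≤ q t := fun t => schreierNorm_nonneg F _
  have hdecomp : ∀ t, P t (∑ j ∈ J, c j • z j) =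
      ∑ j ∈ J₁ t, c j • P t (z j) + ∑ j ∈ J₂ t, c j • P t (z j) := by
    intro t
    simp only [hP, hJ₁, hJ₂, intervalProj_sum_smul]
    rw [Finset.sum_filter, Finset.sum_filter, ← Finset.sum_add_distrib]
    refine Finset.sum_congr rfl fun j hj => ?_
    by_cases h2 : m j < k t
    · rw [if_neg (fun h => absurd h.1 (not_le.2 h2)), if_pos h2, zero_add]
    · rw [if_neg h2, add_zero]
      split_ifs with h3
      · rfl
      · by_contra hne
        obtain ⟨i, hi, hi2⟩ := hPz t j fun h => hne (by simp only [hP] at h; rw [h, smul_zero])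
        exact h3 ⟨not_lt.1 h2, (hz j hj i hi).1.trans_lt hi2.2⟩
  have hmain : ∀ t, schreierNorm F (P t (∑ j ∈ J, c j • z j)) ≤
      2 * schreierNorm F (P t y) + q t := by
    intro t
    rw [hdecomp]
    refine (schreierNorm_add_le F _ _).trans (add_le_add_left ?_ _)
    simp only [hP, hy, intervalProj_sum_smul_single]
    refine schreierNorm_sum_smul_le hF.hereditary hF.spreading hF.singleton_mem hm (J₁ t) c
      (fun j hj i hi => hz j (Finset.mem_filter.1 hj).1 i ?_)
      fun j hj => ?_
    · intro h
      rw [intervalProj_apply, h, ite_self] at hi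
      exact hi rfl
    · exact (schreierNorm_mono (abs_intervalProj_apply_le _ _ _)).trans
        ((schreierNorm_le_baernsteinNorm hp _).trans (hz1 j (Finset.mem_filter.1 hj).1))
  have hqp : ∀ t, q t ^ p ≤ ∑ j ∈ J, |c j| ^ p * schreierNorm F (P t (z j)) ^ p := by
    intro t
    have hterm : ∀ j, 0 ≤ |c j| ^ p * schreierNorm F (P t (z j)) ^ p := fun j =>
      mul_nonneg (Real.rpow_nonneg (abs_nonneg _) _) (Real.rpow_nonneg (schreierNorm_nonneg F _) _)
    by_cases h : ∃ j ∈ J₂ t, P t (z j) ≠ 0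
    · obtain ⟨j, hj, hne⟩ := h
      -- Two distinct blocks that begin before `k t` and both reach past it would overlap.
      have huniq : ∀ l ∈ J₂ t, l ≠ j → c l • P t (z l) = 0 := by
        intro l hl hlj
        by_contra hne'
        obtain ⟨i, hi, hi2⟩ := hPz t j hne
        obtain ⟨i', hi', hi2'⟩ := hPz t l fun h => hne' (by rw [h, smul_zero])
        rw [Finset.mem_filter] at hj hl
        have a1 := hm.lt_iff_lt.1 ((hl.2.trans_le hi2.1).trans (hz j hj.1 i hi).2)
        have a2 := hm.lt_iff_lt.1 ((hj.2.trans_le hi2'.1).trans (hz l hl.1 i' hi').2)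
        omega
      have : q t ^ p = |c j| ^ p * schreierNorm F (P t (z j)) ^ p := by
        simp only [hq]
        rw [Finset.sum_eq_single_of_mem j hj huniq, schreierNorm_smul,
          Real.mul_rpow (abs_nonneg _) (schreierNorm_nonneg F _)]
      rw [this]
      exact Finset.single_le_sum (f := fun j => |c j| ^ p * schreierNorm F (P t (z j)) ^ p)
        (fun j _ => hterm j) (Finset.mem_filter.1 hj).1
    · push Not at h
      have : q t = 0 := by
        simp only [hq]
        rw [Finset.sum_eq_zero fun j hj => by rw [h j hj, smul_zero], schreierNorm_zero]
      rw [this, Real.zero_rpow hp0.ne']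
      exact Finset.sum_nonneg fun j _ => hterm j
  have hqsum : ∑ t ∈ Finset.range T, q t ^ p ≤ baernsteinNorm F p y ^ p := by
    calc _ ≤ ∑ t ∈ Finset.range T, ∑ j ∈ J, |c j| ^ p * schreierNorm F (P t (z j)) ^ p :=
          Finset.sum_le_sum fun t _ => hqp t
      _ = ∑ j ∈ J, |c j| ^ p * ∑ t ∈ Finset.range T, schreierNorm F (P t (z j)) ^ p := by
          rw [Finset.sum_comm]
          exact Finset.sum_congr rfl fun j _ => by rw [Finset.mul_sum]
      _ ≤ ∑ j ∈ J, |c j| ^ p := by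
          refine Finset.sum_le_sum fun j hj => ?_
          refine mul_le_of_le_one_right (Real.rpow_nonneg (abs_nonneg _) _) ?_
          exact (sum_rpow_le_of_strictMono hp (z j) hk T).trans
            (Real.rpow_le_one (baernsteinNorm_nonneg F p _) (hz1 j hj) hp0.le)
      _ ≤ _ := sum_abs_rpow_le hF.singleton_mem hp hm J c
  have hxsum : ∑ t ∈ Finset.range T, (2 * schreierNorm F (P t y)) ^ p ≤
      (2 * baernsteinNorm F p y) ^ p := by
    rw [Real.mul_rpow zero_le_two hy0]
    simp only [Real.mul_rpow zero_le_two (schreierNorm_nonneg F _), ← Finset.mul_sum]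
    exact mul_le_mul_of_nonneg_left (sum_rpow_le_of_strictMono hp y hk T) (by positivity)
  -- Minkowski in `ℓ_p` adds the factor `2` from blocks beginning inside the intervals to the factor
  -- `1` from blocks running over.
  have hmink := Real.Lp_add_le_of_nonneg (s := Finset.range T)
    (f := fun t => 2 * schreierNorm F (P t y)) (g := q) hp
    (fun t _ => mul_nonneg zero_le_two (schreierNorm_nonneg F _)) fun t _ => hq0 t
  rw [one_div] at hmink
  have hroot : ∀ {s b : ℝ}, 0 ≤ s → 0 ≤ b → s ≤ b ^ p → s ^ p⁻¹ ≤ b := fun hs hb h =>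
    (Real.rpow_inv_le_iff_of_pos hs hb hp0).2 h
  have e1 := hroot (Finset.sum_nonneg fun t _ =>
    Real.rpow_nonneg (mul_nonneg zero_le_two (schreierNorm_nonneg F _)) _) (by positivity) hxsum
  have e2 := hroot (Finset.sum_nonneg fun t _ => Real.rpow_nonneg (hq0 t) _) hy0 hqsum
  have hs0 : ∀ t, 0 ≤ 2 * schreierNorm F (P t y) + q t := fun t =>
    add_nonneg (mul_nonneg zero_le_two (schreierNorm_nonneg F _)) (hq0 t)
  calc _ ≤ ∑ t ∈ Finset.range T, (2 * schreierNorm F (P t y) + q t) ^ p :=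
        Finset.sum_le_sum fun t _ =>
          Real.rpow_le_rpow (schreierNorm_nonneg F _) (hmain t) hp0.le
    _ ≤ _ := by
        rw [← Real.rpow_inv_le_iff_of_pos (Finset.sum_nonneg fun t _ => Real.rpow_nonneg (hs0 t) _)
          (by positivity) hp0]
        linarith

/-- Moving the coefficients to the right increases the Baernstein norm. -/
theorem baernsteinNorm_le_of_rightShift (hF : IsRegular F) (hp : 1 ≤ p) {m k : ℕ → ℕ+}
    (hm : StrictMono m) (hk : StrictMono k) (hmk : ∀ n, m n ≤ k n) (J : Finset ℕ) (c : ℕ → ℝ) :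
    baernsteinNorm F p (∑ j ∈ J, c j • Finsupp.single (m j) (1 : ℝ)) ≤
      baernsteinNorm F p (∑ j ∈ J, c j • Finsupp.single (k j) (1 : ℝ)) := by
  classical
  set y := ∑ j ∈ J, c j • Finsupp.single (k j) (1 : ℝ) with hy
  refine baernsteinNorm_le_of_forall hp (baernsteinNorm_nonneg F p _) fun l hl T => ?_
  have hex : ∀ i : ℕ+, ∃ n, i ≤ m n := fun i => by
    refine ⟨i, ?_⟩
    have : StrictMono fun n => (m n : ℕ) := fun a b hab => hm hab
    exact_mod_cast this.id_le (i : ℕ)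
  -- `ν i` is the first index with `m n ≥ i`, so the interval `[l t, l (t + 1))` is carried to `[k
  -- (ν (l t)), k (ν (l (t + 1))))`. The image may be empty, hence only monotone endpoints.
  set ν : ℕ+ → ℕ := fun i => Nat.find (hex i) with hν
  have hν_le : ∀ i n, i ≤ m n → ν i ≤ n := fun i n h => Nat.find_min' (hex i) h
  have hlt_ν : ∀ i n, m n < i → n < ν i := fun i n h =>
    hm.lt_iff_lt.1 (h.trans_le (Nat.find_spec (hex i)))
  have hmono : Monotone fun t => k (ν (l t)) := fun s t hst => hk.monotone
    (hν_le _ _ ((hl.monotone hst).trans (Nat.find_spec (hex (l t)))))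
  refine le_trans (Finset.sum_le_sum fun t _ => ?_) (sum_rpow_le_of_monotone hp y hmono T)
  refine Real.rpow_le_rpow (schreierNorm_nonneg F _) ?_ (by linarith)
  rw [hy, intervalProj_sum_smul_single, intervalProj_sum_smul_single]
  set J₁ := J.filter fun j => l t ≤ m j ∧ m j < l (t + 1)
  set J₂ := J.filter fun j => k (ν (l t)) ≤ k j ∧ k j < k (ν (l (t + 1)))
  have hJ : J₁ ⊆ J₂ := fun j hj => by
    rw [Finset.mem_filter] at hj ⊢
    exact ⟨hj.1, hk.monotone (hν_le _ _ hj.2.1), hk (hlt_ν _ _ hj.2.2)⟩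
  refine schreierNorm_le_of_forall (schreierNorm_nonneg F _) fun E hE => ?_
  set B := J₁.filter fun j => m j ∈ E with hB
  have hBE : B.image m ⊆ E := fun i hi => by
    obtain ⟨j, hj, rfl⟩ := Finset.mem_image.1 hi
    exact (Finset.mem_filter.1 hj).2
  have hBF : B.image k ∈ F := hF.spreading B m k (hm.strictMonoOn _) (hk.strictMonoOn _)
    (fun j _ => hmk j) (hF.hereditary E hE _ hBE)
  refine le_trans (le_of_eq ?_) (le_schreierNorm hBF _)
  rw [sum_image_abs_sum_smul_single hk J₂ c ((Finset.filter_subset _ _).trans hJ),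
    ← sum_image_abs_sum_smul_single hm J₁ c (Finset.filter_subset _ _)]
  refine (Finset.sum_subset hBE fun i hi hiB => ?_).symm
  rw [abs_eq_zero, Finsupp.finsetSum_apply]
  refine Finset.sum_eq_zero fun j hj => ?_
  have : i ≠ m j := by
    rintro rfl
    exact hiB (Finset.mem_image_of_mem m (Finset.mem_filter.2 ⟨hj, hi⟩))
  rw [Finsupp.smul_apply, Finsupp.single_eq_of_ne this, smul_zero]

/-! ### Flat vectors and tails of functionals -/

theorem sum_schreierNorm_intervalProj_le {k : ℕ → ℕ+} (hk : StrictMono k) (x : ℕ+ →₀ ℝ)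
    (T : ℕ) : ∑ t ∈ Finset.range T, schreierNorm F (intervalProj (k t) (k (t + 1)) x) ≤
      ∑ i ∈ x.support, |x i| := by
  classical
  have hle : ∀ t, schreierNorm F (intervalProj (k t) (k (t + 1)) x) ≤
      ∑ i ∈ x.support with k t ≤ i ∧ i < k (t + 1), |x i| := fun t => by
    refine schreierNorm_le_of_forall (Finset.sum_nonneg fun _ _ => abs_nonneg _) fun E _ => ?_
    refine (sum_abs_le E _).trans_eq ?_
    rw [intervalProj, Finsupp.support_filter]
    exact Finset.sum_congr rfl fun i hi => by
      rw [Finsupp.filter_apply, if_pos (Finset.mem_filter.1 hi).2]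
  refine (Finset.sum_le_sum fun t _ => hle t).trans ?_
  rw [← Finset.sum_biUnion]
  · refine Finset.sum_le_sum_of_subset_of_nonneg ?_ fun _ _ _ => abs_nonneg _
    exact Finset.biUnion_subset.2 fun t _ => Finset.filter_subset _ _
  · intro s _ t _ hst
    refine Finset.disjoint_left.2 fun i hi hi' => hst ?_
    rw [Finset.mem_filter] at hi hi'
    have a1 := hk.lt_iff_lt.1 (hi.2.1.trans_lt hi'.2.2)
    have a2 := hk.lt_iff_lt.1 (hi'.2.1.trans_lt hi.2.2)
    omega

/-- Each interval norm `s` satisfies `s ≤ δ`, so `s ^ p ≤ δ ^ (p - 1) * s`, and the sum of the `s`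
is at most the `ℓ₁` norm. As `p > 1`, the bound tends to zero with `δ`. -/
theorem baernsteinNorm_rpow_le_of_schreierNorm_le (hp : 1 < p) {x : ℕ+ →₀ ℝ} {δ : ℝ}
    (hx : schreierNorm F x ≤ δ) (hx1 : ∑ i ∈ x.support, |x i| ≤ 1) :
    baernsteinNorm F p x ^ p ≤ δ ^ (p - 1) := by
  have hδ : 0 ≤ δ := (schreierNorm_nonneg F x).trans hx
  refine baernsteinNorm_rpow_le_of_forall hp.le fun k hk T => ?_
  calc _ ≤ ∑ t ∈ Finset.range T,
        δ ^ (p - 1) * schreierNorm F (intervalProj (k t) (k (t + 1)) x) := by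
        refine Finset.sum_le_sum fun t _ => ?_
        set s := schreierNorm F (intervalProj (k t) (k (t + 1)) x)
        have hs0 : 0 ≤ s := schreierNorm_nonneg F _
        have hs : s ≤ δ := (schreierNorm_mono (abs_intervalProj_apply_le _ _ _)).trans hx
        calc s ^ p = s ^ (p - 1) * s := by
              conv_rhs => rw [← Real.rpow_one s]
              rw [Real.rpow_one s, ← Real.rpow_add_one' hs0 (by linarith), sub_add_cancel]
          _ ≤ _ := mul_le_mul_of_nonneg_right
              (Real.rpow_le_rpow hs0 hs (by linarith)) hs0
    _ ≤ δ ^ (p - 1) * 1 := by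
        rw [← Finset.mul_sum]
        exact mul_le_mul_of_nonneg_left ((sum_schreierNorm_intervalProj_le hk x T).trans hx1)
          (Real.rpow_nonneg hδ _)
    _ = _ := mul_one _

theorem exists_baernsteinNorm_le (hF : IsRegular F) (hp : 1 < p) {M : Set ℕ+} (hM : M.Infinite)
    {η : ℝ} (hη : 0 < η) : ∃ b : ℕ+ →₀ ℝ, (b.support : Set ℕ+) ⊆ M ∧
      (∀ i, 0 ≤ b i) ∧ ∑ i ∈ b.support, b i = 1 ∧ baernsteinNorm F p b ≤ η := by
  -- The threshold `δ` solves `δ ^ (p - 1) = η ^ p`.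
  obtain ⟨b, b0, bM, b1, bE⟩ := hF.small M hM ((η ^ p) ^ (p - 1)⁻¹) (by positivity)
  refine ⟨b, bM, b0, b1, ?_⟩
  have h := baernsteinNorm_rpow_le_of_schreierNorm_le (F := F) (x := b)
    (δ := (η ^ p) ^ (p - 1)⁻¹) hp
    (schreierNorm_le_of_forall (by positivity) fun E hE => by
      simpa [abs_of_nonneg (b0 _)] using bE E hE)
    (by simpa [abs_of_nonneg (b0 _)] using b1.le)
  rw [Real.rpow_inv_rpow (by positivity) (by linarith)] at h
  exact (Real.rpow_le_rpow_iff (baernsteinNorm_nonneg F p b) hη.le (by linarith)).1 h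

/-- The tails of a functional bounded for the Baernstein norm tend to zero. -/
theorem exists_forall_abs_le_of_bounded (hF : IsRegular F) (hp : 1 < p)
    (f : (ℕ+ →₀ ℝ) →ₗ[ℝ] ℝ) {C : ℝ} (hf : ∀ x, |f x| ≤ C * baernsteinNorm F p x)
    {ε : ℝ} (hε : 0 < ε) : ∃ K : ℕ+, ∀ x : ℕ+ →₀ ℝ, (∀ i, x i ≠ 0 → K ≤ i) →
      |f x| ≤ ε * baernsteinNorm F p x := by
  by_contra! h
  have hC : 0 ≤ C := by
    have := (abs_nonneg _).trans (hf (Finsupp.single 1 1))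
    rwa [baernsteinNorm_single hF.singleton_mem hp.le, mul_one] at this
  obtain ⟨z, m, hm, hz, -, hzi⟩ := exists_successive
    (P := fun x => baernsteinNorm F p x ≤ 1 ∧ ε ≤ f x) (by
      intro K
      obtain ⟨x, hxK, hx⟩ := h K
      have hx0 : x ≠ 0 := by
        rintro rfl
        rw [map_zero, abs_zero] at hx
        exact absurd hx (not_lt.2 (mul_nonneg hε.le (baernsteinNorm_nonneg F p _)))
      obtain ⟨i, hi⟩ := Finsupp.ne_iff.1 hx0
      have hpos : 0 < baernsteinNorm F p x :=
        (abs_pos.2 hi).trans_le (abs_apply_le_baernsteinNorm hF.singleton_mem hp.le x i)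
      have hfx : 0 < |f x| := (mul_pos hε hpos).trans hx
      have hsgn : |SignType.sign (f x) * (1 : ℝ)| = 1 := by
        rcases lt_or_gt_of_ne (abs_pos.1 hfx) with h | h <;> simp [h]
      rw [mul_one] at hsgn
      -- Normalizing and correcting the sign makes `f` at least `ε`, not merely large in modulus, so
      -- that convex combinations keep the bound.
      set s : ℝ := (SignType.sign (f x) : ℝ) * (baernsteinNorm F p x)⁻¹ with hs
      have hs0 : s ≠ 0 := mul_ne_zero (fun h => by simp [h] at hsgn) (inv_ne_zero hpos.ne')
      refine ⟨s • x, smul_ne_zero hs0 hx0, fun i hi => hxK i ?_, ?_, ?_⟩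
      · exact right_ne_zero_of_mul hi
      · rw [baernsteinNorm_smul F hp.le, hs, abs_mul, hsgn, one_mul, abs_of_pos (inv_pos.2 hpos),
          inv_mul_cancel₀ hpos.ne']
      · rw [map_smul, smul_eq_mul, hs, mul_right_comm, sign_mul_self, ← div_eq_mul_inv,
          le_div_iff₀ hpos]
        exact hx.le)
  -- With this `η`, `3 * C * η < ε`; the `+ 1` covers `C = 0`.
  obtain ⟨b, bM, b0, b1, bη⟩ := exists_baernsteinNorm_le hF hp
    (Set.infinite_range_of_injective hm.injective) (η := ε / (3 * C + 1) / 2) (by positivity)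
  obtain ⟨J, hJb, hJ1⟩ := exists_finset_eq_sum_smul_single hm bM
  have e1 := baernsteinNorm_sum_smul_le hF hp.le hm J (fun j => b (m j)) (fun j _ => hzi j)
    fun j _ => (hz j).1
  rw [hJb] at e1
  have e2 : ε ≤ f (∑ j ∈ J, b (m j) • z j) := by
    rw [map_sum]
    calc ε = ∑ j ∈ J, b (m j) * ε := by rw [← Finset.sum_mul, hJ1, b1, one_mul]
      _ ≤ _ := Finset.sum_le_sum fun j _ => by
          rw [map_smul, smul_eq_mul]
          exact mul_le_mul_of_nonneg_left (hz j).2 (b0 _)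
  have e3 := (le_abs_self _).trans (hf (∑ j ∈ J, b (m j) • z j))
  have e4 : C * baernsteinNorm F p (∑ j ∈ J, b (m j) • z j) ≤
      C * (3 * (ε / (3 * C + 1) / 2)) :=
    mul_le_mul_of_nonneg_left (e1.trans (mul_le_mul_of_nonneg_left bη (by norm_num))) hC
  have e5 : C * (3 * (ε / (3 * C + 1) / 2)) < ε := by
    have : C * (3 * (ε / (3 * C + 1) / 2)) = ε * ((3 * C) / (3 * C + 1) / 2) := by ring
    rw [this]
    refine mul_lt_of_lt_one_right hε ?_
    rw [div_div, div_lt_one (by positivity)]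
    linarith
  linarith

/-! ### The unit vector basis of the Baernstein space -/

/-- The canonical linear map from `c₀₀` to the Baernstein space. -/
def embed (F : Set (Finset ℕ+)) (p : ℝ) (hp : 1 ≤ p) : (ℕ+ →₀ ℝ) →ₗ[ℝ] Space F p hp where
  toFun x := ((PreSpace.of F p hp x : PreSpace F p hp) : Space F p hp)
  map_add' x y := UniformSpace.Completion.coe_add (α := PreSpace F p hp) (PreSpace.of F p hp x)
    (PreSpace.of F p hp y)
  map_smul' c x := UniformSpace.Completion.coe_smul (X := PreSpace F p hp) c (PreSpace.of F p hp x)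

theorem norm_embed (hp : 1 ≤ p) (x : ℕ+ →₀ ℝ) : ‖embed F p hp x‖ = baernsteinNorm F p x :=
  UniformSpace.Completion.norm_coe (E := PreSpace F p hp) (PreSpace.of F p hp x)

theorem denseRange_embed (hp : 1 ≤ p) : DenseRange (embed F p hp) :=
  UniformSpace.Completion.denseRange_coe (α := PreSpace F p hp)

theorem embed_single (hp : 1 ≤ p) (n : ℕ+) :
    embed F p hp (Finsupp.single n 1) = unitVector F p hp n := rfl

theorem embed_sum_smul_single {ι : Type*} (hp : 1 ≤ p) (J : Finset ι) (c : ι → ℝ) (v : ι → ℕ+) :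
    embed F p hp (∑ j ∈ J, c j • Finsupp.single (v j) (1 : ℝ)) =
      ∑ j ∈ J, c j • unitVector F p hp (v j) := by
  simp only [map_sum, map_smul, embed_single]

/-- The coordinate functionals on `c₀₀`. -/
def preCoord (h1 : ∀ i, {i} ∈ F) (hp : 1 ≤ p) (n : ℕ+) : PreSpace F p hp →L[ℝ] ℝ :=
  LinearMap.mkContinuous
    { toFun := fun x => (show ℕ+ →₀ ℝ from x) n
      map_add' := fun _ _ => rfl
      map_smul' := fun _ _ => rfl } 1 fun x => by
    rw [one_mul]
    exact abs_apply_le_baernsteinNorm h1 hp x n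

/-- The coordinate functionals on the Baernstein space. -/
def coordFunctional (h1 : ∀ i, {i} ∈ F) (hp : 1 ≤ p) (n : ℕ+) : StrongDual ℝ (Space F p hp) :=
  (preCoord h1 hp n).extend (UniformSpace.Completion.toComplL (𝕜 := ℝ) (E := PreSpace F p hp))

theorem coordFunctional_embed (h1 : ∀ i, {i} ∈ F) (hp : 1 ≤ p) (n : ℕ+) (x : ℕ+ →₀ ℝ) :
    coordFunctional h1 hp n (embed F p hp x) = x n :=
  ContinuousLinearMap.extend_eq (preCoord h1 hp n)
    (UniformSpace.Completion.denseRange_coe)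
    (UniformSpace.Completion.isUniformInducing_coe _) (PreSpace.of F p hp x)

theorem sum_coordFunctional_embed (h1 : ∀ i, {i} ∈ F) (hp : 1 ≤ p) (K : ℕ+) (x : ℕ+ →₀ ℝ) :
    ∑ i ∈ Finset.Iic K, coordFunctional h1 hp i (embed F p hp x) • unitVector F p hp i =
      embed F p hp (x.filter (· ≤ K)) := by
  classical
  simp only [coordFunctional_embed]
  rw [← embed_sum_smul_single hp _ x fun i => i]
  congr 1
  ext i
  simp [Finsupp.finsetSum_apply, Finsupp.filter_apply, Finsupp.single_apply]

theorem baernsteinNorm_filter_le (hp : 1 ≤ p) (P : ℕ+ → Prop) [DecidablePred P] (x : ℕ+ →₀ ℝ) :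
    baernsteinNorm F p (x.filter P) ≤ baernsteinNorm F p x :=
  baernsteinNorm_mono hp fun i => by
    rw [Finsupp.filter_apply]
    split_ifs <;> simp

/-- On `c₀₀` the partial sums are restrictions, which do not increase the norm; density extends this
to the completion. -/
theorem norm_sum_coordFunctional_le (h1 : ∀ i, {i} ∈ F) (hp : 1 ≤ p) (K : ℕ+)
    (x : Space F p hp) :
    ‖∑ i ∈ Finset.Iic K, coordFunctional h1 hp i x • unitVector F p hp i‖ ≤ ‖x‖ := by
  refine (denseRange_embed hp).induction_on (p := fun x : Space F p hp =>
    ‖∑ i ∈ Finset.Iic K, coordFunctional h1 hp i x • unitVector F p hp i‖ ≤ ‖x‖) x ?_ fun y => ?_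
  · exact isClosed_le (by fun_prop) continuous_norm
  · rw [sum_coordFunctional_embed, norm_embed, norm_embed]
    exact baernsteinNorm_filter_le hp _ y

/-- A finitely supported approximation equals its own partial sums from some index on, and the
contractive partial sum projections transfer the approximation to `x`. -/
theorem tendsto_sum_coordFunctional (h1 : ∀ i, {i} ∈ F) (hp : 1 ≤ p) (x : Space F p hp) :
    Tendsto (fun K => ∑ i ∈ Finset.Iic K, coordFunctional h1 hp i x • unitVector F p hp i)
      atTop (𝓝 x) := by
  rw [Metric.tendsto_atTop]
  intro ε hε
  obtain ⟨y, hy⟩ := (denseRange_embed hp).exists_dist_lt x (half_pos hε)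
  obtain ⟨K, hK⟩ : ∃ K : ℕ+, ∀ i ∈ y.support, i ≤ K := y.support.exists_le
  refine ⟨K, fun N hN => ?_⟩
  have hyN : y.filter (· ≤ N) = y :=
    Finsupp.filter_eq_self_iff _ _ |>.2 fun i hi => (hK i (Finsupp.mem_support_iff.2 hi)).trans hN
  have e := sum_coordFunctional_embed h1 hp N y
  rw [hyN] at e
  have e2 : ∑ i ∈ Finset.Iic N, coordFunctional h1 hp i x • unitVector F p hp i - embed F p hp y =
      ∑ i ∈ Finset.Iic N, coordFunctional h1 hp i (x - embed F p hp y) •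
        unitVector F p hp i := by
    nth_rewrite 1 [← e]
    simp only [map_sub, sub_smul, Finset.sum_sub_distrib]
  calc _ ≤ dist (∑ i ∈ Finset.Iic N, coordFunctional h1 hp i x • unitVector F p hp i)
        (embed F p hp y) + dist (embed F p hp y) x := dist_triangle _ _ _
    _ ≤ dist x (embed F p hp y) + dist (embed F p hp y) x := by
        gcongr
        rw [dist_eq_norm, dist_eq_norm, e2]
        exact norm_sum_coordFunctional_le h1 hp N _
    _ < ε := by rw [dist_comm (embed F p hp y)]; linarith

/-- The unit vectors form a Schauder basis of the Baernstein space. -/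
def unitBasis (h1 : ∀ i, {i} ∈ F) (hp : 1 ≤ p) : Basis (Space F p hp) where
  basis := unitVector F p hp
  coord := coordFunctional h1 hp
  ortho i j := by
    rw [← embed_single, coordFunctional_embed]
    have h (_ : DecidableEq ℕ+) : Finsupp.single j (1 : ℝ) i = (Pi.single j 1 : ℕ+ → ℝ) i := by
      rw [Finsupp.single_apply, Pi.single_apply]
      exact if_congr eq_comm rfl rfl
    exact h _
  expansion x := by
    rw [HasSum, SummationFilter.conditional_filter_eq_map_Iic, tendsto_map'_iff]
    exact tendsto_sum_coordFunctional h1 hp x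

theorem unitBasis_apply (h1 : ∀ i, {i} ∈ F) (hp : 1 ≤ p) (n : ℕ+) :
    unitBasis h1 hp n = unitVector F p hp n := rfl

theorem unitBasis_coord_embed (h1 : ∀ i, {i} ∈ F) (hp : 1 ≤ p) (n : ℕ+) (x : ℕ+ →₀ ℝ) :
    (unitBasis h1 hp).coord n (embed F p hp x) = x n :=
  coordFunctional_embed h1 hp n x

theorem norm_unitBasis (h1 : ∀ i, {i} ∈ F) (hp : 1 ≤ p) (n : ℕ+) : ‖unitBasis h1 hp n‖ = 1 := by
  rw [unitBasis_apply, ← embed_single, norm_embed, baernsteinNorm_single h1 hp]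

/-! ### The properties of the basis -/

theorem oneUnconditional_unitBasis (h1 : ∀ i, {i} ∈ F) (hp : 1 ≤ p) :
    OneUnconditional (unitBasis h1 hp) := by
  intro a s hs
  have h : ∀ c : ℕ+ → ℝ, ‖∑ i ∈ a.support, c i • unitVector F p hp i‖ =
      baernsteinNorm F p (∑ i ∈ a.support, c i • Finsupp.single i 1) := fun c => by
    rw [← embed_sum_smul_single hp _ c fun i => i, norm_embed]
  have happ : ∀ (c : ℕ+ → ℝ) (i : ℕ+), (∑ j ∈ a.support, c j • Finsupp.single j (1 : ℝ)) i =
      if i ∈ a.support then c i else 0 := fun c i => by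
    classical
    simp only [Finsupp.finsetSum_apply, Finsupp.smul_apply, Finsupp.single_apply, smul_eq_mul,
      mul_ite, mul_one, mul_zero, Finset.sum_ite_eq']
  have habs : ∀ i, |(∑ j ∈ a.support, (s j * a j) • Finsupp.single j (1 : ℝ)) i| =
      |(∑ j ∈ a.support, a j • Finsupp.single j (1 : ℝ)) i| := fun i => by
    rw [happ (fun j => s j * a j), happ]
    split_ifs
    · rw [abs_mul, hs, one_mul]
    · rfl
  simp only [Finsupp.sum, unitBasis_apply]
  rw [h fun i => s i * a i, h a]
  exact le_antisymm (baernsteinNorm_mono hp fun i => (habs i).le)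
    (baernsteinNorm_mono hp fun i => (habs i).ge)

theorem shrinking_unitBasis (hF : IsRegular F) (hp : 1 < p) :
    Shrinking (unitBasis hF.singleton_mem hp.le) := by
  rw [Shrinking, eq_top_iff]
  intro f _
  rw [← SetLike.mem_coe, Submodule.topologicalClosure_coe, Metric.mem_closure_iff]
  intro ε hε
  obtain ⟨K, hK⟩ := exists_forall_abs_le_of_bounded hF hp
    (f.toLinearMap ∘ₗ embed F p hp.le) (C := ‖f‖) (fun x => by
      rw [← norm_embed hp.le, ← Real.norm_eq_abs]
      exact f.le_opNorm _) (half_pos hε)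
  -- The approximant agrees with `f` on the first `K` unit vectors. The difference sees only the
  -- part of a vector beyond `K`, where `f` is at most `ε / 2` times the norm.
  refine ⟨∑ i ∈ Finset.Iic K, f (unitVector F p hp.le i) •
    (unitBasis hF.singleton_mem hp.le).coord i, ?_, ?_⟩
  · exact Submodule.sum_mem _ fun i _ => Submodule.smul_mem _ _ (Submodule.subset_span ⟨i, rfl⟩)
  rw [dist_eq_norm]
  refine lt_of_le_of_lt (ContinuousLinearMap.opNorm_le_bound _ (half_pos hε).le fun x => ?_)
    (half_lt_self hε)
  set g := f - ∑ i ∈ Finset.Iic K, f (unitVector F p hp.le i) •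
    (unitBasis hF.singleton_mem hp.le).coord i with hg
  refine (denseRange_embed hp.le).induction_on (p := fun x : Space F p hp.le =>
    ‖g x‖ ≤ ε / 2 * ‖x‖) x ?_ fun y => ?_
  · exact isClosed_le (by fun_prop) (by fun_prop)
  · have hgy : g (embed F p hp.le y) =
        f (embed F p hp.le (y.filter fun i => ¬ i ≤ K)) := by
      have e := sum_coordFunctional_embed hF.singleton_mem hp.le K y
      have e2 := Finsupp.filter_add_filter_not y (· ≤ K)
      have e3 : f (embed F p hp.le (y.filter (· ≤ K))) =
          ∑ i ∈ Finset.Iic K, f (unitVector F p hp.le i) * y i := by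
        rw [← e, map_sum]
        refine Finset.sum_congr rfl fun i _ => ?_
        rw [map_smul, coordFunctional_embed, smul_eq_mul, mul_comm]
      nth_rewrite 1 [hg, ← e2]
      rw [sub_apply, e2]
      nth_rewrite 1 [← e2]
      rw [map_add, map_add, e3, sum_apply]
      simp [unitBasis_coord_embed]
    rw [hgy, norm_embed]
    refine (hK _ fun i hi => ?_).trans ?_
    · rw [Finsupp.filter_apply] at hi
      exact (not_le.1 (of_not_not fun h => hi (if_neg h))).le
    · exact mul_le_mul_of_nonneg_left (baernsteinNorm_filter_le hp.le _ y) (half_pos hε).le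

theorem boundedlyComplete_unitBasis (h1 : ∀ i, {i} ∈ F) (hp : 1 ≤ p) :
    BoundedlyComplete (unitBasis h1 hp) := by
  intro c hc
  set x : ℕ+ → ℕ+ →₀ ℝ := fun N => ∑ i ∈ Finset.Icc 1 N, c i • Finsupp.single i (1 : ℝ) with hx
  have hxN : ∀ N, ∑ i ∈ Finset.Icc 1 N, c i • unitBasis h1 hp i = embed F p hp (x N) :=
    fun N => (embed_sum_smul_single hp _ c fun i => i).symm
  have hxi : ∀ N i, x N i = if i ≤ N then c i else 0 := fun N i => by
    classical
    simp [hx, Finsupp.finsetSum_apply, Finsupp.single_apply]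
  simp only [hxN, norm_embed] at hc ⊢
  have hp0 : 0 < p := by linarith
  set s : ℕ+ → ℝ := fun N => baernsteinNorm F p (x N) ^ p with hs
  -- The lower `p`-estimate for `x N` and `x M - x N`, which are separated by the cut at `N + 1`.
  have hdiff : ∀ N M, N ≤ M → baernsteinNorm F p (x M - x N) ^ p ≤ s M - s N := by
    intro N M hNM
    have h := baernsteinNorm_rpow_add_le (F := F) hp (x := x N) (y := x M - x N) (m := N + 1)
      (fun i hi => PNat.lt_add_one_iff.2 (by
        by_contra h
        exact hi (by rw [hxi, if_neg h])))
      (fun i hi => PNat.add_one_le_iff.2 (by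
        by_contra h
        have h' : i ≤ N := not_lt.1 h
        exact hi (by rw [Finsupp.sub_apply, hxi, hxi, if_pos h', if_pos (h'.trans hNM),
          sub_self])))
    rw [add_sub_cancel] at h
    simp only [hs]
    linarith
  have hmono : Monotone s := fun N M hNM => by
    have := (Real.rpow_nonneg (baernsteinNorm_nonneg F p (x M - x N)) p).trans (hdiff N M hNM)
    linarith
  have hbdd : BddAbove (Set.range s) := by
    obtain ⟨B, hB⟩ := hc
    refine ⟨B ^ p, ?_⟩
    rintro _ ⟨N, rfl⟩
    exact Real.rpow_le_rpow (baernsteinNorm_nonneg F p _) (hB ⟨N, rfl⟩) hp0.le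
  have hcauchy := (tendsto_atTop_ciSup hmono hbdd).cauchySeq
  refine cauchySeq_tendsto_of_complete (Metric.cauchySeq_iff'.2 fun ε hε => ?_)
  obtain ⟨N, hN⟩ := Metric.cauchySeq_iff'.1 hcauchy (ε ^ p) (by positivity)
  refine ⟨N, fun M hM => ?_⟩
  rw [dist_eq_norm, ← map_sub, norm_embed]
  refine (Real.rpow_lt_rpow_iff (baernsteinNorm_nonneg F p _) hε.le hp0).1 ?_
  exact (hdiff N M hM).trans_lt ((le_abs_self _).trans_lt (hN M hM))

theorem rightDominant_unitBasis (hF : IsRegular F) (hp : 1 ≤ p) :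
    RightDominant 1 (unitBasis hF.singleton_mem hp) := by
  intro m k hm hk hmk a
  simp only [Finsupp.sum, unitBasis_apply]
  rw [one_mul, ← embed_sum_smul_single, ← embed_sum_smul_single, norm_embed, norm_embed]
  exact baernsteinNorm_le_of_rightShift hF hp hm hk hmk a.support a

/-- Coordinates determine a vector through its expansion. Blocks in the completion therefore come
from `c₀₀`, where the block estimate was proved. -/
theorem exists_embed_eq_of_finite_supp (h1 : ∀ i, {i} ∈ F) (hp : 1 ≤ p) {x : Space F p hp}
    (hx : (supp (unitBasis h1 hp) x).Finite) : ∃ y, embed F p hp y = x := by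
  refine ⟨Finsupp.ofSupportFinite (fun i => (unitBasis h1 hp).coord i x) hx, ?_⟩
  set y := Finsupp.ofSupportFinite (fun i => (unitBasis h1 hp).coord i x) hx
  have h0 : ∀ i, (unitBasis h1 hp).coord i (x - embed F p hp y) = 0 := fun i => by
    rw [map_sub, unitBasis_coord_embed]
    exact sub_self _
  have h := tendsto_sum_coordFunctional h1 hp (x - embed F p hp y)
  have h' : ∀ K, ∑ i ∈ Finset.Iic K, coordFunctional h1 hp i (x - embed F p hp y) •
      unitVector F p hp i = 0 := fun K => Finset.sum_eq_zero fun i _ => by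
    rw [show coordFunctional h1 hp i (x - embed F p hp y) = 0 from h0 i, zero_smul]
  simp only [h'] at h
  exact (sub_eq_zero.1 (tendsto_nhds_unique h tendsto_const_nhds)).symm

theorem upperBlockEstimates_unitBasis (hF : IsRegular F) (hp : 1 ≤ p) :
    UpperBlockEstimates 3 (unitBasis hF.singleton_mem hp) (unitBasis hF.singleton_mem hp) := by
  intro z m hz hm a
  choose w hw using fun n => exists_embed_eq_of_finite_supp hF.singleton_mem hp (hz.finite_supp n)
  have hmem : ∀ n i, i ∈ supp (unitBasis hF.singleton_mem hp) (z n) ↔ w n i ≠ 0 := fun n i => by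
    rw [← hw, supp, Set.mem_ofPred_eq, unitBasis_coord_embed]
  have hlt : ∀ n i, w n i ≠ 0 → i < m (n + 1) := fun n i hi =>
    hz.successive n i ((hmem n i).2 hi) _ (hm (n + 1)).1
  have h := baernsteinNorm_sum_smul_le hF hp
    (strictMono_nat_of_lt_succ fun n => hlt n _ ((hmem n _).1 (hm n).1)) (z := w) a.support a
    (fun j _ i hi => ⟨(hm j).2 ((hmem j i).2 hi), hlt j i hi⟩)
    (fun j _ => by rw [← norm_embed hp, hw, hz.norm_eq_one])
  rw [← norm_embed hp, ← norm_embed hp, embed_sum_smul_single, map_sum] at h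
  simpa only [map_smul, hw] using! h

theorem UpperBlockEstimates.mono {X U : Type*} [NormedAddCommGroup X] [NormedSpace ℝ X]
    [NormedAddCommGroup U] [NormedSpace ℝ U] {C D : ℝ} {b : Basis X} {u : ℕ+ → U}
    (h : UpperBlockEstimates C b u) (hCD : C ≤ D) : UpperBlockEstimates D b u :=
  fun z m hz hm a => (h z m hz hm a).trans (mul_le_mul_of_nonneg_right hCD (norm_nonneg _))

end Baernstein

end

theorem mainTheorem6
    (a : Ordinal.{0} → ℕ+ → Ordinal.{0}) (ha : Baernstein.IsLimitSystem a)
    (α : Ordinal.{0}) (hα : α < Ordinal.omega 1) (p : ℝ) (hp : 1 < p) :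
    ∃ b : Baernstein.Basis (Baernstein.Space (Baernstein.schreierFamily a α) p hp.le),
      b.basis = Baernstein.unitVector (Baernstein.schreierFamily a α) p hp.le ∧
      (∀ n, ‖b n‖ = 1) ∧
      Baernstein.OneUnconditional b ∧
      Baernstein.Shrinking b ∧
      Baernstein.BoundedlyComplete b ∧
      Baernstein.RightDominant 1 b ∧
      Baernstein.UpperBlockEstimates 4 b b := by
  have hF := Baernstein.isRegular_schreierFamily ha α hα
  exact ⟨Baernstein.unitBasis hF.singleton_mem hp.le, rfl,
    Baernstein.norm_unitBasis hF.singleton_mem hp.le,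
    Baernstein.oneUnconditional_unitBasis hF.singleton_mem hp.le,
    Baernstein.shrinking_unitBasis hF hp,
    Baernstein.boundedlyComplete_unitBasis hF.singleton_mem hp.le,
    Baernstein.rightDominant_unitBasis hF hp.le,
    -- The block estimate holds with constant `3`, which is weakened to `4`.
    (Baernstein.upperBlockEstimates_unitBasis hF hp.le).mono (by norm_num)⟩
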